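/- **Theorem 4 (Weak soundness).** *Terms and time.* Consider pure $\lambda$-terms (up to renaming of bound variables) with size $|x|=1$, $|\lambda x.t|=|t|+1$, $|tu|=|t|+|u|$. Values are variables and abstractions. Weak call-by-value reduction $\to$ is generated by $(\lambda x.t)v\to t[v/x]$ for $v$ a value, and is closed under $t_1u\to t_2u$ and $ut_1\to ut_2$ whenever $t_1\to t_2$ (no reduction under $\lambda$). A step $t\to u$ costs $\max\{|u|-|t|,1\}$, and costs add up along reduction sequences. $\mathrm{Time}(t)$ is defined iff $t$ reduces to a value, and is then the cost of the evaluation of $t$ to a value. *Types.* Linear formulas $L,M$ and formulas $A,B$ are given by $$L,M::=\alpha\mid\forall\alpha L\mid\mu\alpha L\mid L\multimap M,\qquad A,B::=L\mid\forall\alpha A\mid L\multimap B\mid A\Rightarrow B,$$ where $\mu\alpha L$ is allowed only if $\alpha$ occurs only positively in $L$. A judgment $\Gamma;\Delta\vdash t:A$ has finite contexts $\Gamma$ (assigning formulas to variables) and $\Delta$ (assigning linear formulas to variables), all variables of $\Gamma,\Delta$ being distinct. The rules are as follows, where $L$ always denotes a linear formula: - $x:A;\ \vdash x:A$ and $;x:L\vdash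 x:L$. - From $\Gamma;\Delta\vdash t:\mu\alpha L$ infer $\Gamma;\Delta\vdash t:L[\mu\alpha L/\alpha]$, and conversely. - From $\Gamma;\Delta\vdash t:A$ with $\alpha$ not free in $\Gamma;\Delta$ infer $\Gamma;\Delta\vdash t:\forall\alpha A$. From $\Gamma;\Delta\vdash t:\forall\alpha A$ infer $\Gamma;\Delta\vdash t:A[L/\alpha]$. - From $\Gamma_1;\Delta\vdash t:A\Rightarrow B$ and $\Gamma_2;\ \vdash u:A$ infer $\Gamma_1,\Gamma_2;\Delta\vdash tu:B$. From $\Gamma,z:A;\Delta\vdash t:B$ infer $\Gamma;\Delta\vdash\lambda z.t:A\Rightarrow B$. - From $\Gamma_1;\Delta_1\vdash t:L\multimap B$ and $\Gamma_2;\Delta_2\vdash u:L$ infer $\Gamma_1,\Gamma_2;\Delta_1,\Delta_2\vdash tu:B$. From $\Gamma;\Delta,z:L\vdash t:B$ infer $\Gamma;\Delta\vdash\lambda z.t:L\multimap B$. - Contraction: from $\Gamma,x:A,y:A;\Delta\vdash t:B$ infer $\Gamma,z:A;\Delta\vdash t[z/x,z/y]:B$. - Dereliction: from $\Gamma;\Delta,x:L\vdash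 t:B$ infer $\Gamma,x:L;\Delta\vdash t:B$. - Weakening: from $\Gamma;\Delta\vdash t:B$ infer $\Gamma,\Gamma';\Delta,\Delta'\vdash t:B$. *Church words.* Let $\mathbf W=\forall\alpha\,\big((\alpha\multimap\alpha)\Rightarrow(\alpha\multimap\alpha)\Rightarrow(\alpha\multimap\alpha)\big)$, and for $w=i_1\cdots i_n\in\{0,1\}^*$ let $\mathbf w=\lambda f_0.\lambda f_1.\lambda x.\,f_{i_1}(f_{i_2}(\cdots(f_{i_n}x)\cdots))$. *Statement.* Let $L$ be a linear formula and suppose that $\vdash t:\mathbf W\Rightarrow L$ is derivable (with both contexts empty). Then there is a polynomial $P$ such that for every $w\in\{0,1\}^*$, $\mathrm{Time}(t\,\mathbf w)$ is defined and $\mathrm{Time}(t\,\mathbf w)\le P(|w|)$, where $|w|$ is the length of $w$. -/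

import Mathlib

namespace DIAL

/-! ### Pure lambda terms

Terms up to renaming of bound variables, in locally nameless style: `fvar x` is the variable named
`x`, bound variables are indices `bvar i`. The actual lambda terms are those without dangling
indices; all terms built from `fvar`, `app` and `abs` (see below) are of this kind. -/

inductive Term : Type
  | bvar : ℕ → Term
  | fvar : ℕ → Term
  | lam : Term → Term
  | app : Term → Term → Term

namespace Term

/-- Replace the bound index `k` by `u` (a term without dangling indices). -/
def openAt (u : Term) : ℕ → Term → Term
  | k, bvar i => if i = k then u else bvar i
  | _, fvar x => fvar x
  | k, lam t => lam (openAt u (k + 1) t)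
  | k, app t s => app (openAt u k t) (openAt u k s)

/-- Replace the free variable `x` by the bound index `k`. -/
def closeAt (x : ℕ) : ℕ → Term → Term
  | _, bvar i => bvar i
  | k, fvar y => if y = x then bvar k else fvar y
  | k, lam t => lam (closeAt x (k + 1) t)
  | k, app t s => app (closeAt x k t) (closeAt x k s)

/-- The abstraction `λ x. t` of the named variable `x` in `t`. -/
def abs (x : ℕ) (t : Term) : Term := lam (closeAt x 0 t)

/-- `rename x z t` is `t[z/x]`, for variables `x` and `z`. -/
def rename (x z : ℕ) : Term → Term
  | bvar i => bvar i
  | fvar y => if y = x then fvar z else fvar y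
  | lam t => lam (rename x z t)
  | app t s => app (rename x z t) (rename x z s)

/-- The size: `|x| = 1`, `|λ x. t| = |t| + 1`, `|t u| = |t| + |u|`. -/
def size : Term → ℕ
  | bvar _ => 1
  | fvar _ => 1
  | lam t => size t + 1
  | app t s => size t + size s

/-- Values are variables and abstractions. -/
inductive IsValue : Term → Prop
  | fvar (x : ℕ) : IsValue (fvar x)
  | lam (t : Term) : IsValue (lam t)

/-- One step of weak call-by-value reduction. -/
inductive Step : Term → Term → Prop
  | beta (t v : Term) : IsValue v → Step (app (lam t) v) (openAt v 0 t)
  | appL {t₁ t₂ : Term} (u : Term) : Step t₁ t₂ → Step (app t₁ u) (app t₂ u)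
  | appR {t₁ t₂ : Term} (u : Term) : Step t₁ t₂ → Step (app u t₁) (app u t₂)

/-- `Cost t n u`: the term `t` reduces to `u` with cost `n`. A step from `t` to `u` costs
`max (|u| - |t|) 1` (the truncation of the subtraction is harmless inside the maximum). -/
inductive Cost : Term → ℕ → Term → Prop
  | refl (t : Term) : Cost t 0 t
  | step {t u : Term} : Step t u → Cost t (max (size u - size t) 1) u
  | trans {s t u : Term} {n m : ℕ} : Cost s n t → Cost t m u → Cost s (n + m) u

/-- `HasTime t n`: the term `t` evaluates to a value and `n` is the cost of an evaluation,
that is, `Time(t)` is defined and equal to `n`. -/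
def HasTime (t : Term) (n : ℕ) : Prop := ∃ v, IsValue v ∧ Cost t n v

/-- The body `f_{i₁}(f_{i₂}(…(f_{iₙ} x)…))` for the word `i₁ i₂ … iₙ`
(`false` is the bit 0 and `true` is the bit 1). -/
def churchBody (f₀ f₁ x : Term) : List Bool → Term
  | [] => x
  | b :: w => app (if b then f₁ else f₀) (churchBody f₀ f₁ x w)

/-- The Church word `λ f₀. λ f₁. λ x. f_{i₁}(f_{i₂}(…(f_{iₙ} x)…))`. -/
def churchWord (w : List Bool) : Term :=
  abs 0 (abs 1 (abs 2 (churchBody (fvar 0) (fvar 1) (fvar 2) w)))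

end Term

/-! ### Formulas

Propositional variables are de Bruijn indices. `Formula` is the type of raw expressions;
`IsLinear` and `IsFormula` carve out the linear formulas and the formulas. -/

inductive Formula : Type
  | var : ℕ → Formula
  | all : Formula → Formula
  | mu : Formula → Formula
  | lolli : Formula → Formula → Formula
  | imp : Formula → Formula → Formula

namespace Formula

/-- The extension of a renaming of propositional variables to the scope of one more binder. -/
def upRen (ρ : ℕ → ℕ) : ℕ → ℕ
  | 0 => 0
  | n + 1 => ρ n + 1

/-- Renaming of propositional variables. -/
def ren : (ℕ → ℕ) → Formula → Formula
  | ρ, var n => var (ρ n)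
  | ρ, all A => all (ren (upRen ρ) A)
  | ρ, mu A => mu (ren (upRen ρ) A)
  | ρ, lolli A B => lolli (ren ρ A) (ren ρ B)
  | ρ, imp A B => imp (ren ρ A) (ren ρ B)

/-- Bring a formula into the scope of one new propositional variable (with index `0`). -/
def shift (A : Formula) : Formula := ren Nat.succ A

/-- The extension of a substitution to the scope of one more binder. -/
def upSubst (σ : ℕ → Formula) : ℕ → Formula
  | 0 => var 0
  | n + 1 => shift (σ n)

/-- Simultaneous capture-avoiding substitution for the propositional variables. -/
def subst : (ℕ → Formula) → Formula → Formula
  | σ, var n => σ n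
  | σ, all A => all (subst (upSubst σ) A)
  | σ, mu A => mu (subst (upSubst σ) A)
  | σ, lolli A B => lolli (subst σ A) (subst σ B)
  | σ, imp A B => imp (subst σ A) (subst σ B)

/-- The substitution of `L` for the variable `0`, the other indices being lowered by one. -/
def instSubst (L : Formula) : ℕ → Formula
  | 0 => L
  | n + 1 => var n

/-- `A[L/α]`, where `A` is the body of a binder for `α`. -/
def inst (A L : Formula) : Formula := subst (instSubst L) A

/-- `OccursOnly true n A`: the variable `n` occurs only positively in `A`;
`OccursOnly false n A`: it occurs only negatively. -/
def OccursOnly : Bool → ℕ → Formula → Prop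
  | true, _, var _ => True
  | false, n, var m => m ≠ n
  | b, n, all A => OccursOnly b (n + 1) A
  | b, n, mu A => OccursOnly b (n + 1) A
  | b, n, lolli A B => OccursOnly (!b) n A ∧ OccursOnly b n B
  | b, n, imp A B => OccursOnly (!b) n A ∧ OccursOnly b n B

/-- Linear formulas: `L, M ::= α | ∀ α L | μ α L | L ⊸ M`,
with `α` occurring only positively in the body of `μ α`. -/
inductive IsLinear : Formula → Prop
  | var (n : ℕ) : IsLinear (var n)
  | all {L : Formula} : IsLinear L → IsLinear (all L)
  | mu {L : Formula} : IsLinear L → OccursOnly true 0 L → IsLinear (mu L)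
  | lolli {L M : Formula} : IsLinear L → IsLinear M → IsLinear (lolli L M)

/-- Formulas: `A, B ::= L | ∀ α A | L ⊸ B | A ⇒ B`. -/
inductive IsFormula : Formula → Prop
  | linear {L : Formula} : IsLinear L → IsFormula L
  | all {A : Formula} : IsFormula A → IsFormula (all A)
  | lolli {L B : Formula} : IsLinear L → IsFormula B → IsFormula (lolli L B)
  | imp {A B : Formula} : IsFormula A → IsFormula B → IsFormula (imp A B)

/-- The type of Church words, `∀ α. (α ⊸ α) ⇒ (α ⊸ α) ⇒ (α ⊸ α)`. -/
def churchW : Formula :=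
  all (imp (lolli (var 0) (var 0)) (imp (lolli (var 0) (var 0)) (lolli (var 0) (var 0))))

end Formula

/-! ### Typing -/

/-- Finite collections of assignments `x : A`. -/
abbrev Ctx : Type := Multiset (ℕ × Formula)

namespace Ctx

/-- The variables to which the assignments in `Γ` refer are pairwise distinct. -/
def Distinct (Γ : Ctx) : Prop := (Γ.map Prod.fst).Nodup

/-- Bring all formulas into the scope of one new propositional variable. -/
def shift (Γ : Ctx) : Ctx := Γ.map (fun a => (a.1, a.2.shift))

end Ctx

open Term Formula in
/-- `Typed Γ Δ t A` is the judgment `Γ; Δ ⊢ t : A`. In a judgment, the variables of `Γ` and `Δ`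
together are distinct; this is a side condition wherever a rule could break it. In `allI`, the
side condition that `α` is not free in `Γ; Δ` is expressed by shifting the contexts. -/
inductive Typed : Ctx → Ctx → Term → Formula → Prop
  | ax1 (x : ℕ) {A : Formula} : IsFormula A → Typed {(x, A)} 0 (fvar x) A
  | ax2 (x : ℕ) {L : Formula} : IsLinear L → Typed 0 {(x, L)} (fvar x) L
  | muE {Γ Δ : Ctx} {t : Term} {L : Formula} :
      Typed Γ Δ t (mu L) → Typed Γ Δ t (inst L (mu L))
  | muI {Γ Δ : Ctx} {t : Term} {L : Formula} :
      IsLinear (mu L) → Typed Γ Δ t (inst L (mu L)) → Typed Γ Δ t (mu L)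
  | allI {Γ Δ : Ctx} {t : Term} {A : Formula} :
      Typed Γ.shift Δ.shift t A → Typed Γ Δ t (all A)
  | allE {Γ Δ : Ctx} {t : Term} {A L : Formula} :
      IsLinear L → Typed Γ Δ t (all A) → Typed Γ Δ t (inst A L)
  | impE {Γ₁ Γ₂ Δ : Ctx} {t u : Term} {A B : Formula} :
      Ctx.Distinct (Γ₁ + Γ₂ + Δ) →
      Typed Γ₁ Δ t (imp A B) → Typed Γ₂ 0 u A → Typed (Γ₁ + Γ₂) Δ (app t u) B
  | impI {Γ Δ : Ctx} {z : ℕ} {t : Term} {A B : Formula} :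
      Typed ((z, A) ::ₘ Γ) Δ t B → Typed Γ Δ (Term.abs z t) (imp A B)
  | lolliE {Γ₁ Γ₂ Δ₁ Δ₂ : Ctx} {t u : Term} {L B : Formula} :
      Ctx.Distinct (Γ₁ + Γ₂ + (Δ₁ + Δ₂)) →
      Typed Γ₁ Δ₁ t (lolli L B) → Typed Γ₂ Δ₂ u L →
      Typed (Γ₁ + Γ₂) (Δ₁ + Δ₂) (app t u) B
  | lolliI {Γ Δ : Ctx} {z : ℕ} {t : Term} {L B : Formula} :
      Typed Γ ((z, L) ::ₘ Δ) t B → Typed Γ Δ (Term.abs z t) (lolli L B)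
  | contr {Γ Δ : Ctx} {x y z : ℕ} {t : Term} {A B : Formula} :
      Ctx.Distinct (((z, A) ::ₘ Γ) + Δ) →
      Typed ((x, A) ::ₘ (y, A) ::ₘ Γ) Δ t B →
      Typed ((z, A) ::ₘ Γ) Δ (rename y z (rename x z t)) B
  | derel {Γ Δ : Ctx} {x : ℕ} {t : Term} {L B : Formula} :
      Typed Γ ((x, L) ::ₘ Δ) t B → Typed ((x, L) ::ₘ Γ) Δ t B
  | weak {Γ Γ' Δ Δ' : Ctx} {t : Term} {B : Formula} :
      Ctx.Distinct (Γ + Γ' + (Δ + Δ')) →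
      (∀ a ∈ Γ', IsFormula a.2) → (∀ a ∈ Δ', IsLinear a.2) →
      Typed Γ Δ t B → Typed (Γ + Γ') (Δ + Δ') t B

end DIAL

/-! The proof is a realizability argument in which values carry credit. A formula denotes a set of
pairs of a value and a credit, and `Ev X t c` says that `c` pays both for the evaluation of `t` and
for the credit of its value. For `L ⊸ B` credits add up: a linear variable occurs at most once, so
substituting for it never enlarges the term and the β-step costs 1. For `A ⇒ B` the argument may be
copied, and the price of an application depends on the size, the credit and the resource of the
argument. The resource of a function records this dependence as a functional on polynomials.

Resources stay under control because `∀` is instantiated by linear formulas only and `μ` binds in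
linear formulas only, and these contain no `⇒`. The nesting of `⇒` in a formula, its shape, is
therefore stable under instantiation, and a single resource serves all candidates at once. The fixed
point `μ` is interpreted by Knaster–Tarski among the candidates.

Induction on derivations (`Typed.sound`) gives every typed term a credit and a resource that do not
mention the number `n` at which polynomials are evaluated. A Church word realizes its type with
credit 0 and a resource common to all words, provided that `n` is its length
(`churchWord_mem_real`). Applying `t` to it yields one polynomial for all words. Finally, reduction
has the diamond property with equal costs, so all evaluations of a term have the same cost and the
bound holds for each of them. -/

namespace DIAL

namespace Term

/-! ### Costs of reduction sequences -/

/-- The cost of a step from `t` to `u`. -/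
def weight (t u : Term) : ℕ := max (size u - size t) 1

theorem IsValue.not_step {v u : Term} (hv : IsValue v) : ¬ Step v u := by
  intro h
  cases hv <;> cases h

/-- The diamond property, with equal costs along both sides. -/
theorem Step.diamond {t u : Term} (h : Step t u) : ∀ {u' : Term}, Step t u' →
    u = u' ∨ ∃ s, Step u s ∧ Step u' s ∧ weight t u + weight u s = weight t u' + weight u' s := by
  induction h with
  | beta t v hv =>
    intro u' h'
    cases h' with
    | beta => exact Or.inl rfl
    | appL _ h => exact absurd h (IsValue.lam t).not_step
    | appR _ h => exact absurd h hv.not_step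
  | @appL t₁ t₂ u h ih =>
    intro u' h'
    cases h' with
    | beta => exact absurd h (IsValue.lam _).not_step
    | appL _ h' =>
      rcases ih h' with rfl | ⟨s, h₁, h₂, hw⟩
      · exact Or.inl rfl
      · refine Or.inr ⟨app s u, h₁.appL u, h₂.appL u, ?_⟩
        simp only [weight, size] at hw ⊢
        omega
    | @appR _ u₂ _ h' =>
      -- Steps in the two halves of an application commute, and the cost of a step does not depend
      -- on the surrounding term.
      refine Or.inr ⟨app t₂ u₂, h'.appR _, h.appL _, ?_⟩
      simp only [weight, size]
      omega
  | @appR t₁ t₂ u h ih =>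
    intro u' h'
    cases h' with
    | beta _ _ hv => exact absurd h hv.not_step
    | appR _ h' =>
      rcases ih h' with rfl | ⟨s, h₁, h₂, hw⟩
      · exact Or.inl rfl
      · refine Or.inr ⟨app u s, h₁.appR u, h₂.appR u, ?_⟩
        simp only [weight, size] at hw ⊢
        omega
    | @appL _ u₂ _ h' =>
      refine Or.inr ⟨app u₂ t₂, h'.appL _, h.appR _, ?_⟩
      simp only [weight, size]
      omega

/-- Reduction sequences as lists of steps, with their costs. -/
inductive Steps : Term → ℕ → Term → Prop
  | refl (t : Term) : Steps t 0 t
  | head {t u v : Term} {n : ℕ} : Step t u → Steps u n v → Steps t (weight t u + n) v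

theorem Steps.trans {s t u : Term} {n m : ℕ} (h : Steps s n t) (h' : Steps t m u) :
    Steps s (n + m) u := by
  induction h with
  | refl => simpa using h'
  | head h _ ih => rw [add_assoc]; exact .head h (ih h')

theorem Cost.steps {t u : Term} {n : ℕ} (h : Cost t n u) : Steps t n u := by
  induction h with
  | refl t => exact .refl t
  | step h => exact .head h (.refl _)
  | trans _ _ ih₁ ih₂ => exact ih₁.trans ih₂

/-- Since the diamond closes in exactly one step on each side with equal total cost, any first step
can be moved to the front of an evaluation without changing its cost. -/
theorem Steps.strip {t u v : Term} {n : ℕ} (h : Steps t n v) (hv : IsValue v) (hu : Step t u) :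
    ∃ m, n = weight t u + m ∧ Steps u m v := by
  induction h generalizing u with
  | refl => exact absurd hu hv.not_step
  | @head t u' v n h h' ih =>
    rcases h.diamond hu with rfl | ⟨s, h₁, h₂, hw⟩
    · exact ⟨n, rfl, h'⟩
    · obtain ⟨m, rfl, hm⟩ := ih hv h₁
      exact ⟨weight u s + m, by omega, .head h₂ hm⟩

theorem Steps.unique {t v v' : Term} {n n' : ℕ} (h : Steps t n v) (hv : IsValue v)
    (h' : Steps t n' v') (hv' : IsValue v') : n = n' ∧ v = v' := by
  induction h generalizing n' with
  | refl =>
    cases h' with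
    | refl => exact ⟨rfl, rfl⟩
    | head h _ => exact absurd h hv.not_step
  | head h _ ih =>
    obtain ⟨m, rfl, hm⟩ := h'.strip hv' h
    obtain ⟨rfl, rfl⟩ := ih hv hm
    exact ⟨rfl, rfl⟩

theorem Cost.unique {t v v' : Term} {n n' : ℕ} (h : Cost t n v) (hv : IsValue v)
    (h' : Cost t n' v') (hv' : IsValue v') : n = n' ∧ v = v' :=
  h.steps.unique hv h'.steps hv'

/-- The cost of a step is at least the growth in size, so a bound on the cost also bounds the value
reached. This provides the size bounds demanded of arguments of `⇒`. -/
theorem Cost.size_le {t u : Term} {n : ℕ} (h : Cost t n u) : size u ≤ size t + n := by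
  induction h <;> omega

theorem Cost.appL {t t' : Term} {n : ℕ} (u : Term) (h : Cost t n t') :
    Cost (app t u) n (app t' u) := by
  induction h with
  | refl => exact .refl _
  | step h =>
    have := Cost.step (h.appL u)
    simpa only [size, Nat.add_sub_add_right] using this
  | trans _ _ ih₁ ih₂ => exact ih₁.trans ih₂

theorem Cost.appR {t t' : Term} {n : ℕ} (u : Term) (h : Cost t n t') :
    Cost (app u t) n (app u t') := by
  induction h with
  | refl => exact .refl _
  | step h =>
    have := Cost.step (h.appR u)
    simpa only [size, Nat.add_sub_add_left] using this
  | trans _ _ ih₁ ih₂ => exact ih₁.trans ih₂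

/-! ### Local closure, substitution, occurrences -/

/-- All dangling indices of the term are less than `k`. -/
def LC : ℕ → Term → Prop
  | k, bvar i => i < k
  | _, fvar _ => True
  | k, lam t => LC (k + 1) t
  | k, app t s => LC k t ∧ LC k s

/-- Simultaneous substitution for the free variables. -/
def bind (σ : ℕ → Term) : Term → Term
  | bvar i => bvar i
  | fvar x => σ x
  | lam t => lam (bind σ t)
  | app t s => app (bind σ t) (bind σ s)

/-- The number of occurrences of the free variable `x`. -/
def occ (x : ℕ) : Term → ℕ
  | bvar _ => 0
  | fvar y => if y = x then 1 else 0
  | lam t => occ x t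
  | app t s => occ x t + occ x s

theorem LC.mono {t : Term} {k l : ℕ} (h : LC k t) (hkl : k ≤ l) : LC l t := by
  induction t generalizing k l with
  | bvar i => exact lt_of_lt_of_le h hkl
  | fvar x => trivial
  | lam t ih => exact ih (k := k + 1) h (by omega)
  | app t s iht ihs => exact ⟨iht h.1 hkl, ihs h.2 hkl⟩

theorem LC.closeAt {t : Term} {k : ℕ} (x : ℕ) (h : LC k t) : LC (k + 1) (closeAt x k t) := by
  induction t generalizing k with
  | bvar i => exact Nat.lt_succ_of_lt h
  | fvar y =>
    simp only [Term.closeAt]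
    split_ifs <;> simp [LC]
  | lam t ih => exact ih (k := k + 1) h
  | app t s iht ihs => exact ⟨iht h.1, ihs h.2⟩

theorem LC.bind {t : Term} {k : ℕ} {σ : ℕ → Term} (h : LC k t) (hσ : ∀ x, LC 0 (σ x)) :
    LC k (bind σ t) := by
  induction t generalizing k with
  | bvar i => exact h
  | fvar y => exact (hσ y).mono (Nat.zero_le k)
  | lam t ih => exact ih (k := k + 1) h
  | app t s iht ihs => exact ⟨iht h.1, ihs h.2⟩

theorem LC.rename {t : Term} {k : ℕ} (x z : ℕ) (h : LC k t) : LC k (rename x z t) := by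
  induction t generalizing k with
  | bvar i => exact h
  | fvar y =>
    simp only [Term.rename]
    split_ifs <;> trivial
  | lam t ih => exact ih (k := k + 1) h
  | app t s iht ihs => exact ⟨iht h.1, ihs h.2⟩

theorem LC.openAt_eq {t : Term} {k : ℕ} (u : Term) (h : LC k t) : openAt u k t = t := by
  induction t generalizing k with
  | bvar i => exact if_neg (ne_of_lt h)
  | fvar y => rfl
  | lam t ih => exact congrArg lam (ih (k := k + 1) h)
  | app t s iht ihs => exact congrArg₂ app (iht h.1) (ihs h.2)

/-- The terms `σ x` have no dangling indices, so opening affects only the index that closing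
created. Thus the contractum of an instance of `λ z. t` is again an instance of `t`, and β-steps
become updates of `σ`. -/
theorem openAt_bind_closeAt {t : Term} {k : ℕ} {σ : ℕ → Term} (u : Term) (z : ℕ) (h : LC k t)
    (hσ : ∀ x, LC 0 (σ x)) :
    openAt u k (bind σ (closeAt z k t)) = bind (Function.update σ z u) t := by
  induction t generalizing k with
  | bvar i => exact if_neg (ne_of_lt h)
  | fvar y =>
    by_cases hy : y = z
    · subst hy
      simp [closeAt, bind, openAt]
    · simp only [closeAt, if_neg hy, bind, Function.update_of_ne hy]
      exact ((hσ y).mono (Nat.zero_le k)).openAt_eq u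
  | lam t ih => exact congrArg lam (ih (k := k + 1) h)
  | app t s iht ihs => exact congrArg₂ app (iht h.1) (ihs h.2)

theorem bind_fvar (t : Term) : bind fvar t = t := by
  induction t with
  | bvar i => rfl
  | fvar y => rfl
  | lam t ih => exact congrArg lam ih
  | app t s iht ihs => exact congrArg₂ app iht ihs

theorem bind_rename_rename (σ : ℕ → Term) (x y z : ℕ) (t : Term) :
    bind σ (rename y z (rename x z t)) =
      bind (Function.update (Function.update σ x (σ z)) y (σ z)) t := by
  induction t with
  | bvar i => rfl
  | fvar w =>
    by_cases hx : w = x <;> by_cases hy : w = y <;> by_cases hz : z = y <;>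
      simp_all [rename, bind]
  | lam t ih => exact congrArg lam ih
  | app t s iht ihs => exact congrArg₂ app iht ihs

theorem occ_closeAt_self (x k : ℕ) (t : Term) : occ x (closeAt x k t) = 0 := by
  induction t generalizing k with
  | bvar i => rfl
  | fvar y =>
    simp only [closeAt]
    split_ifs with h <;> simp [occ, h]
  | lam t ih => exact ih (k + 1)
  | app t s iht ihs => simp [closeAt, occ, iht, ihs]

theorem occ_closeAt_of_ne {x z : ℕ} (h : x ≠ z) (k : ℕ) (t : Term) :
    occ x (closeAt z k t) = occ x t := by
  induction t generalizing k with
  | bvar i => rfl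
  | fvar y =>
    simp only [closeAt]
    split_ifs with h'
    · subst h'; simp [occ, Ne.symm h]
    · rfl
  | lam t ih => exact ih (k + 1)
  | app t s iht ihs => simp [closeAt, occ, iht, ihs]

theorem occ_abs_of_ne {x z : ℕ} (h : x ≠ z) (t : Term) : occ x (abs z t) = occ x t :=
  occ_closeAt_of_ne h 0 t

theorem occ_rename_self {x z : ℕ} (h : x ≠ z) (t : Term) : occ x (rename x z t) = 0 := by
  induction t with
  | bvar i => rfl
  | fvar y =>
    simp only [rename]
    split_ifs with h' <;> simp [occ, h', h.symm]
  | lam t ih => exact ih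
  | app t s iht ihs => simp [rename, occ, iht, ihs]

theorem occ_rename_of_ne {w x z : ℕ} (hx : w ≠ x) (hz : w ≠ z) (t : Term) :
    occ w (rename x z t) = occ w t := by
  induction t with
  | bvar i => rfl
  | fvar y =>
    simp only [rename]
    split_ifs with h'
    · subst h'; simp [occ, hx.symm, hz.symm]
    · rfl
  | lam t ih => exact ih
  | app t s iht ihs => simp [rename, occ, iht, ihs]

theorem occ_le_size (x : ℕ) (t : Term) : occ x t ≤ size t := by
  induction t with
  | bvar i => simp [occ]
  | fvar y => simp only [occ, size]; split_ifs <;> omega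
  | lam t ih => simp only [occ, size]; omega
  | app t s iht ihs => simp only [occ, size]; omega

theorem size_bind_update_le (σ : ℕ → Term) (z k : ℕ) (u t : Term) :
    size (bind (Function.update σ z u) t) ≤ size (bind σ (closeAt z k t)) + occ z t * size u := by
  induction t generalizing k with
  | bvar i => simp [bind, closeAt, occ, size]
  | fvar y =>
    by_cases hy : y = z
    · subst hy; simp [bind, closeAt, occ, size]
    · simp [bind, closeAt, occ, hy]
  | lam t ih => have := ih (k + 1); simp only [bind, closeAt, occ, size]; omega
  | app t s iht ihs =>
    have := iht k; have := ihs k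
    simp only [bind, closeAt, occ, size, add_mul]; omega

theorem size_bind_le {σ : ℕ → Term} {K : ℕ} {t : Term}
    (h : ∀ x, occ x t ≠ 0 → size (σ x) ≤ K) : size (bind σ t) ≤ size t * (1 + K) := by
  induction t with
  | bvar i => simp [bind, size]
  | fvar y => have := h y (by simp [occ]); simp only [bind, size]; omega
  | lam t ih => have := ih h; simp only [bind, size, add_mul]; omega
  | app t s iht ihs =>
    have := iht fun x hx => h x (by simp only [occ]; omega)
    have := ihs fun x hx => h x (by simp only [occ]; omega)
    simp only [bind, size, add_mul]; omega

/-- The cost of a β-step in which a locally closed value is substituted in an instance of a term. -/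
theorem cost_beta_bind {t u : Term} {σ : ℕ → Term} (z : ℕ) (ht : LC 0 t)
    (hσ : ∀ x, LC 0 (σ x)) (hu : IsValue u) :
    ∃ m, Cost (app (bind σ (abs z t)) u) m (bind (Function.update σ z u) t) ∧
      m ≤ occ z t * size u + 1 ∧ (occ z t ≤ 1 → m ≤ 1) := by
  have h := Cost.step (Step.beta (bind σ (closeAt z 0 t)) u hu)
  rw [openAt_bind_closeAt u z ht hσ] at h
  refine ⟨_, h, ?_⟩
  have hs := size_bind_update_le σ z 0 u t
  simp only [size]
  refine ⟨by omega, fun h₁ => ?_⟩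
  -- With at most one occurrence the contractum is smaller than the redex, so the maximum in the
  -- cost is 1.
  have : occ z t * size u ≤ 1 * size u := Nat.mul_le_mul_right _ h₁
  omega

end Term

end DIAL

namespace DIAL

namespace Formula

/-! ### Linearity under renaming and substitution -/

theorem upRen_injective {ρ : ℕ → ℕ} (h : Function.Injective ρ) : Function.Injective (upRen ρ) := by
  rintro (_ | m) (_ | n) e
  · rfl
  · simp [upRen] at e
  · simp [upRen] at e
  · simp only [upRen, Nat.add_right_cancel_iff] at e
    rw [h e]

theorem occursOnly_ren {ρ : ℕ → ℕ} (h : Function.Injective ρ) (A : Formula) (b : Bool) (n : ℕ) :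
    OccursOnly b (ρ n) (ren ρ A) ↔ OccursOnly b n A := by
  induction A generalizing b n ρ with
  | var m => cases b <;> simp [ren, OccursOnly, h.eq_iff]
  | all A ih => simpa [ren, OccursOnly, upRen] using ih (upRen_injective h) b (n + 1)
  | mu A ih => simpa [ren, OccursOnly, upRen] using ih (upRen_injective h) b (n + 1)
  | lolli A B ihA ihB => simp [ren, OccursOnly, ihA h, ihB h]
  | imp A B ihA ihB => simp [ren, OccursOnly, ihA h, ihB h]

/-- The direction from left to right recovers the linearity of context formulas from their shifts in
the `allI` rule. Injectivity keeps a renaming from merging variables of opposite polarity. -/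
theorem isLinear_ren {ρ : ℕ → ℕ} (h : Function.Injective ρ) (A : Formula) :
    IsLinear (ren ρ A) ↔ IsLinear A := by
  induction A generalizing ρ with
  | var m => exact ⟨fun _ => .var _, fun _ => .var _⟩
  | all A ih =>
    constructor
    · rintro ⟨⟩
      next h' => exact .all ((ih (upRen_injective h)).1 h')
    · rintro ⟨⟩
      next h' => exact .all ((ih (upRen_injective h)).2 h')
  | mu A ih =>
    have ho := occursOnly_ren (upRen_injective h) A true 0
    constructor
    · intro h'
      cases h' with
      | mu h' o => exact .mu ((ih (upRen_injective h)).1 h') (ho.1 o)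
    · intro h'
      cases h' with
      | mu h' o => exact .mu ((ih (upRen_injective h)).2 h') (ho.2 o)
  | lolli A B ihA ihB =>
    constructor
    · rintro ⟨⟩
      next h₁ h₂ => exact .lolli ((ihA h).1 h₁) ((ihB h).1 h₂)
    · rintro ⟨⟩
      next h₁ h₂ => exact .lolli ((ihA h).2 h₁) ((ihB h).2 h₂)
  | imp A B => exact ⟨nofun, nofun⟩

theorem IsFormula.of_all {A : Formula} (h : IsFormula (Formula.all A)) : IsFormula A := by
  cases h with
  | all h => exact h
  | linear h => cases h with
    | all h => exact .linear h

theorem IsFormula.isLinear_of_mu {A : Formula} (h : IsFormula (mu A)) : IsLinear (mu A) := by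
  cases h with
  | linear h => exact h

theorem IsFormula.of_lolli {A B : Formula} (h : IsFormula (Formula.lolli A B)) :
    IsLinear A ∧ IsFormula B := by
  cases h with
  | lolli h₁ h₂ => exact ⟨h₁, h₂⟩
  | linear h => cases h with
    | lolli h₁ h₂ => exact ⟨h₁, .linear h₂⟩

theorem IsFormula.of_imp {A B : Formula} (h : IsFormula (Formula.imp A B)) :
    IsFormula A ∧ IsFormula B := by
  cases h with
  | imp h₁ h₂ => exact ⟨h₁, h₂⟩
  | linear h => cases h

theorem isFormula_of_ren {ρ : ℕ → ℕ} (h : Function.Injective ρ) {A : Formula}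
    (hA : IsFormula (ren ρ A)) : IsFormula A := by
  induction A generalizing ρ with
  | var m => exact .linear (.var m)
  | all A ih => exact .all (ih (upRen_injective h) hA.of_all)
  | mu A => exact .linear ((isLinear_ren h (mu A)).1 hA.isLinear_of_mu)
  | lolli A B ihA ihB => exact .lolli ((isLinear_ren h A).1 hA.of_lolli.1) (ihB h hA.of_lolli.2)
  | imp A B ihA ihB => exact .imp (ihA h hA.of_imp.1) (ihB h hA.of_imp.2)

theorem isLinear_shift {A : Formula} : IsLinear A.shift ↔ IsLinear A :=
  isLinear_ren Nat.succ_injective A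

theorem occursOnly_ren_of_notMem {ρ : ℕ → ℕ} {n : ℕ} (h : ∀ m, ρ m ≠ n) (A : Formula) (b : Bool) :
    OccursOnly b n (ren ρ A) := by
  induction A generalizing b n ρ with
  | var m => cases b <;> simp [ren, OccursOnly, h m]
  | all A ih =>
    have h' : ∀ m, upRen ρ m ≠ n + 1 := by rintro (_ | m) <;> simp [upRen, h]
    cases b <;> exact ih h' _
  | mu A ih =>
    have h' : ∀ m, upRen ρ m ≠ n + 1 := by rintro (_ | m) <;> simp [upRen, h]
    cases b <;> exact ih h' _
  | lolli A B ihA ihB => cases b <;> exact ⟨ihA h _, ihB h _⟩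
  | imp A B ihA ihB => cases b <;> exact ⟨ihA h _, ihB h _⟩

/-- A substitution that fixes the variable `n` and does not introduce it elsewhere. -/
def Fixes (σ : ℕ → Formula) (n : ℕ) : Prop :=
  σ n = var n ∧ ∀ m, m ≠ n → ∀ b, OccursOnly b n (σ m)

theorem Fixes.up {σ : ℕ → Formula} {n : ℕ} (h : Fixes σ n) : Fixes (upSubst σ) (n + 1) := by
  refine ⟨by simp [upSubst, h.1, shift, ren], ?_⟩
  rintro (_ | m) hm b
  · cases b <;> simp [upSubst, OccursOnly]
  · exact (occursOnly_ren Nat.succ_injective (σ m) b n).2 (h.2 m (by omega) b)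

theorem fixes_upSubst_zero (σ : ℕ → Formula) : Fixes (upSubst σ) 0 := by
  refine ⟨rfl, ?_⟩
  rintro (_ | m) hm b
  · exact absurd rfl hm
  · exact occursOnly_ren_of_notMem (fun m => Nat.succ_ne_zero m) _ b

/-- This carries the positivity condition of `μ` through a substitution, which under the binder
fixes the bound variable and brings in no other occurrence of it. -/
theorem OccursOnly.subst {σ : ℕ → Formula} {A : Formula} {b : Bool} {n : ℕ} (h : OccursOnly b n A)
    (hσ : Fixes σ n) : OccursOnly b n (subst σ A) := by
  induction A generalizing b n σ with
  | var m =>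
    by_cases hm : m = n
    · subst hm
      simpa only [Formula.subst, hσ.1] using h
    · exact hσ.2 m hm b
  | all A ih => cases b <;> exact ih (n := n + 1) h hσ.up
  | mu A ih => cases b <;> exact ih (n := n + 1) h hσ.up
  | lolli A B ihA ihB => cases b <;> exact ⟨ihA h.1 hσ, ihB h.2 hσ⟩
  | imp A B ihA ihB => cases b <;> exact ⟨ihA h.1 hσ, ihB h.2 hσ⟩

theorem isLinear_upSubst {σ : ℕ → Formula} (h : ∀ n, IsLinear (σ n)) (n : ℕ) :
    IsLinear (upSubst σ n) := by
  cases n with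
  | zero => exact .var 0
  | succ n => exact isLinear_shift.2 (h n)

theorem IsLinear.subst {σ : ℕ → Formula} {A : Formula} (hA : IsLinear A)
    (h : ∀ n, IsLinear (σ n)) : IsLinear (subst σ A) := by
  induction hA generalizing σ with
  | var n => exact h n
  | all _ ih => exact .all (ih (isLinear_upSubst h))
  | mu _ o ih => exact .mu (ih (isLinear_upSubst h)) (o.subst (fixes_upSubst_zero σ))
  | lolli _ _ ih₁ ih₂ => exact .lolli (ih₁ h) (ih₂ h)

theorem IsFormula.subst {σ : ℕ → Formula} {A : Formula} (hA : IsFormula A)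
    (h : ∀ n, IsLinear (σ n)) : IsFormula (subst σ A) := by
  induction hA generalizing σ with
  | linear hL => exact .linear (hL.subst h)
  | all _ ih => exact .all (ih (isLinear_upSubst h))
  | lolli hL _ ih => exact .lolli (hL.subst h) (ih h)
  | imp _ _ ih₁ ih₂ => exact .imp (ih₁ h) (ih₂ h)

theorem isLinear_instSubst {L : Formula} (h : IsLinear L) (n : ℕ) : IsLinear (instSubst L n) := by
  cases n with
  | zero => exact h
  | succ n => exact .var n

end Formula

/-! ### Well-formedness of derivable judgments -/

open Term Formula

theorem Ctx.mem_shift {Γ : Ctx} {a : ℕ × Formula} (h : a ∈ Γ) : (a.1, a.2.shift) ∈ Γ.shift :=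
  Multiset.mem_map_of_mem (fun a : ℕ × Formula => (a.1, a.2.shift)) h

theorem Ctx.map_fst_shift (Γ : Ctx) : Γ.shift.map Prod.fst = Γ.map Prod.fst := by
  simp [Ctx.shift]

theorem Ctx.Distinct.mono {Γ Δ : Ctx} (h : Ctx.Distinct Δ) (hl : Γ ≤ Δ) : Ctx.Distinct Γ :=
  Multiset.nodup_of_le (Multiset.map_le_map hl) h

theorem Ctx.Distinct.notMem {Γ : Ctx} {a : ℕ × Formula} (h : Ctx.Distinct (a ::ₘ Γ)) :
    ∀ b ∈ Γ, b.1 ≠ a.1 := by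
  intro b hb e
  simp only [Ctx.Distinct, Multiset.map_cons, Multiset.nodup_cons] at h
  exact h.1 (e ▸ Multiset.mem_map_of_mem Prod.fst hb)

theorem Ctx.Distinct.disjoint {Γ Δ : Ctx} (h : Ctx.Distinct (Γ + Δ)) :
    ∀ a ∈ Γ, ∀ b ∈ Δ, b.1 ≠ a.1 := by
  intro a ha b hb e
  obtain ⟨Γ', rfl⟩ := Multiset.exists_cons_of_mem ha
  rw [Multiset.cons_add] at h
  exact h.notMem b (Multiset.mem_add.2 (Or.inr hb)) e

theorem Typed.distinct {Γ Δ : Ctx} {t : Term} {A : Formula} (h : Typed Γ Δ t A) :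
    Ctx.Distinct (Γ + Δ) := by
  induction h with
  | ax1 | ax2 => simp [Ctx.Distinct]
  | muE _ ih => exact ih
  | muI _ _ ih => exact ih
  | allI _ ih => simpa only [Ctx.Distinct, Multiset.map_add, Ctx.map_fst_shift] using ih
  | allE _ _ ih => exact ih
  | impE h => exact h
  | impI _ ih => rw [Multiset.cons_add] at ih; exact ih.mono (Multiset.le_cons_self _ _)
  | lolliE h => exact h
  | lolliI _ ih => rw [Multiset.add_cons] at ih; exact ih.mono (Multiset.le_cons_self _ _)
  | contr h => exact h
  | derel _ ih => rwa [Multiset.cons_add, ← Multiset.add_cons]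
  | weak h => exact h

theorem Typed.lc {Γ Δ : Ctx} {t : Term} {A : Formula} (h : Typed Γ Δ t A) : LC 0 t := by
  induction h with
  | ax1 | ax2 => trivial
  | muE _ ih => exact ih
  | muI _ _ ih => exact ih
  | allI _ ih => exact ih
  | allE _ _ ih => exact ih
  | impE _ _ _ ih₁ ih₂ => exact ⟨ih₁, ih₂⟩
  | impI _ ih => exact ih.closeAt _
  | lolliE _ _ _ ih₁ ih₂ => exact ⟨ih₁, ih₂⟩
  | lolliI _ ih => exact ih.closeAt _
  | contr _ _ ih => exact (ih.rename _ _).rename _ _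
  | derel _ ih => exact ih
  | weak _ _ _ _ ih => exact ih

theorem Typed.isFormula {Γ Δ : Ctx} {t : Term} {A : Formula} (h : Typed Γ Δ t A) :
    IsFormula A ∧ (∀ a ∈ Γ, IsFormula a.2) ∧ ∀ a ∈ Δ, IsLinear a.2 := by
  induction h with
  | ax1 x hA => simp [hA]
  | ax2 x hL => simp [hL, IsFormula.linear hL]
  | muE _ ih =>
    refine ⟨?_, ih.2⟩
    have hm := ih.1.isLinear_of_mu
    cases hm with
    | mu hL o => exact .linear (hL.subst (isLinear_instSubst (.mu hL o)))
  | muI hL _ ih => exact ⟨.linear hL, ih.2⟩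
  | allI _ ih =>
    exact ⟨.all ih.1, fun a ha => isFormula_of_ren Nat.succ_injective (ih.2.1 _ (Ctx.mem_shift ha)),
      fun a ha => isLinear_shift.1 (ih.2.2 _ (Ctx.mem_shift ha))⟩
  | allE hL _ ih => exact ⟨ih.1.of_all.subst (isLinear_instSubst hL), ih.2⟩
  | impE _ _ _ ih₁ ih₂ =>
    refine ⟨ih₁.1.of_imp.2, fun a ha => ?_, ih₁.2.2⟩
    rcases Multiset.mem_add.1 ha with ha | ha
    exacts [ih₁.2.1 a ha, ih₂.2.1 a ha]
  | impI _ ih =>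
    simp only [Multiset.forall_mem_cons] at ih
    exact ⟨.imp ih.2.1.1 ih.1, ih.2.1.2, ih.2.2⟩
  | lolliE _ _ _ ih₁ ih₂ =>
    refine ⟨ih₁.1.of_lolli.2, fun a ha => ?_, fun a ha => ?_⟩
    · rcases Multiset.mem_add.1 ha with ha | ha
      exacts [ih₁.2.1 a ha, ih₂.2.1 a ha]
    · rcases Multiset.mem_add.1 ha with ha | ha
      exacts [ih₁.2.2 a ha, ih₂.2.2 a ha]
  | lolliI _ ih =>
    simp only [Multiset.forall_mem_cons] at ih
    exact ⟨.lolli ih.2.2.1 ih.1, ih.2.1, ih.2.2.2⟩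
  | contr _ _ ih =>
    simp only [Multiset.forall_mem_cons] at ih ⊢
    exact ⟨ih.1, ih.2.1.2, ih.2.2⟩
  | derel _ ih =>
    simp only [Multiset.forall_mem_cons] at ih ⊢
    exact ⟨ih.1, ⟨.linear ih.2.2.1, ih.2.1⟩, ih.2.2.2⟩
  | weak _ h₁ h₂ _ ih =>
    refine ⟨ih.1, fun a ha => ?_, fun a ha => ?_⟩
    · rcases Multiset.mem_add.1 ha with ha | ha
      exacts [ih.2.1 a ha, h₁ a ha]
    · rcases Multiset.mem_add.1 ha with ha | ha
      exacts [ih.2.2 a ha, h₂ a ha]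

theorem Typed.occ_eq_zero {Γ Δ : Ctx} {t : Term} {A : Formula} (h : Typed Γ Δ t A) {x : ℕ}
    (hx : ∀ a ∈ Γ + Δ, a.1 ≠ x) : occ x t = 0 := by
  induction h with
  | ax1 | ax2 => simpa [occ] using hx
  | muE _ ih => exact ih hx
  | muI _ _ ih => exact ih hx
  | allI _ ih =>
    refine ih fun a ha => ?_
    rw [Ctx.shift, Ctx.shift, ← Multiset.map_add] at ha
    obtain ⟨b, hb, rfl⟩ := Multiset.mem_map.1 ha
    exact hx b hb
  | allE _ _ ih => exact ih hx
  | impE _ _ _ ih₁ ih₂ =>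
    simp only [Multiset.mem_add] at hx ih₁ ih₂
    simp only [occ]
    rw [ih₁ fun a ha => hx a (by tauto), ih₂ fun a ha => hx a (by simp at ha; tauto)]
  | @impI _ _ z _ _ _ _ ih =>
    by_cases hz : x = z
    · subst hz; exact occ_closeAt_self x 0 _
    · refine (occ_closeAt_of_ne hz 0 _).trans (ih ?_)
      simp only [Multiset.cons_add, Multiset.forall_mem_cons]
      exact ⟨Ne.symm hz, hx⟩
  | lolliE _ _ _ ih₁ ih₂ =>
    simp only [Multiset.mem_add] at hx ih₁ ih₂
    simp only [occ]
    rw [ih₁ fun a ha => hx a (by tauto), ih₂ fun a ha => hx a (by tauto)]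
  | @lolliI _ _ z _ _ _ _ ih =>
    by_cases hz : x = z
    · subst hz; exact occ_closeAt_self x 0 _
    · refine (occ_closeAt_of_ne hz 0 _).trans (ih ?_)
      simp only [Multiset.add_cons, Multiset.forall_mem_cons]
      exact ⟨Ne.symm hz, hx⟩
  | @contr _ _ x' y' z t _ _ _ _ ih =>
    simp only [Multiset.cons_add, Multiset.forall_mem_cons] at hx ih
    have hz : x ≠ z := hx.1.symm
    by_cases hy : x = y'
    · subst hy; exact occ_rename_self hz _
    · rw [occ_rename_of_ne hy hz]
      by_cases hx' : x = x'
      · subst hx'; exact occ_rename_self hz _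
      · rw [occ_rename_of_ne hx' hz]
        exact ih ⟨Ne.symm hx', Ne.symm hy, hx.2⟩
  | derel _ ih =>
    refine ih ?_
    rwa [Multiset.add_cons, ← Multiset.cons_add]
  | weak _ _ _ _ ih =>
    refine ih fun a ha => hx a ?_
    simp only [Multiset.mem_add] at ha ⊢
    tauto

/-- Contraction acts on `Γ` only, the argument of a `⇒` has no linear context, and application of a
`⊸` splits the linear context. Distinctness of the variables excludes an occurrence in the other
half. -/
theorem Typed.occ_le_one {Γ Δ : Ctx} {t : Term} {A : Formula} (h : Typed Γ Δ t A)
    {a : ℕ × Formula} (ha : a ∈ Δ) : occ a.1 t ≤ 1 := by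
  induction h generalizing a with
  | ax1 => simp at ha
  | ax2 => simp only [occ]; split_ifs <;> omega
  | muE _ ih => exact ih ha
  | muI _ _ ih => exact ih ha
  | allI _ ih => exact ih (a := (a.1, a.2.shift)) (Ctx.mem_shift ha)
  | allE _ _ ih => exact ih ha
  | impE hd h₁ h₂ ih₁ ih₂ =>
    simp only [occ]
    rw [h₂.occ_eq_zero (x := a.1) fun b hb e => hd.disjoint b (by simp at hb ⊢; tauto) a ha e.symm]
    exact ih₁ ha
  | @impI _ _ z t _ _ h ih =>
    have hz : a.1 ≠ z := by
      have := h.distinct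
      rw [Multiset.cons_add] at this
      exact this.notMem a (Multiset.mem_add.2 (Or.inr ha))
    exact (occ_closeAt_of_ne hz 0 t).trans_le (ih ha)
  | @lolliE Γ₁ Γ₂ Δ₁ Δ₂ _ _ _ _ hd h₁ h₂ ih₁ ih₂ =>
    simp only [occ]
    rcases Multiset.mem_add.1 ha with ha | ha
    · have hd' : Ctx.Distinct (Δ₁ + (Γ₂ + Δ₂)) := hd.mono (by
        rw [show Γ₁ + Γ₂ + (Δ₁ + Δ₂) = Δ₁ + (Γ₂ + Δ₂) + Γ₁ by abel]
        exact Multiset.le_add_right _ _)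
      rw [h₂.occ_eq_zero (x := a.1) (hd'.disjoint a ha)]
      exact ih₁ ha
    · have hd' : Ctx.Distinct (Δ₂ + (Γ₁ + Δ₁)) := hd.mono (by
        rw [show Γ₁ + Γ₂ + (Δ₁ + Δ₂) = Δ₂ + (Γ₁ + Δ₁) + Γ₂ by abel]
        exact Multiset.le_add_right _ _)
      rw [h₁.occ_eq_zero (x := a.1) (hd'.disjoint a ha), zero_add]
      exact ih₂ ha
  | @lolliI _ _ z t _ _ h ih =>
    have hz : a.1 ≠ z := by
      have := h.distinct
      rw [Multiset.add_cons] at this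
      exact this.notMem a (Multiset.mem_add.2 (Or.inr ha))
    exact (occ_closeAt_of_ne hz 0 t).trans_le (ih (Multiset.mem_cons_of_mem ha))
  | @contr Γ Δ x y z t A B hd h ih =>
    have hz : a.1 ≠ z := by
      rw [Multiset.cons_add] at hd
      exact hd.notMem a (Multiset.mem_add.2 (Or.inr ha))
    have hd' := h.distinct
    have hx : a.1 ≠ x := hd'.disjoint (x, A) (by simp) a ha
    have hy : a.1 ≠ y := hd'.disjoint (y, A) (by simp) a ha
    rw [occ_rename_of_ne hy hz, occ_rename_of_ne hx hz]
    exact ih ha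
  | derel _ ih => exact ih (Multiset.mem_cons_of_mem ha)
  | @weak Γ Γ' Δ Δ' t B hd _ _ h ih =>
    rcases Multiset.mem_add.1 ha with ha | ha
    · exact ih ha
    · have hd' : Ctx.Distinct (Δ' + (Γ + Δ)) := hd.mono (by
        rw [show Γ + Γ' + (Δ + Δ') = Δ' + (Γ + Δ) + Γ' by abel]
        exact Multiset.le_add_right _ _)
      rw [h.occ_eq_zero (x := a.1) (hd'.disjoint a ha)]
      omega

end DIAL

namespace DIAL

open Term Formula

/-! ### Resources -/

/-- The shape of a formula, that is, its nesting of intuitionistic implications. -/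
inductive Shape : Type
  | base : Shape
  | arr : Shape → Shape → Shape
  deriving DecidableEq

/-- The resources of a given shape. A resource for an implication takes a bound for the size of the
argument, a credit for the argument, and a resource for it, to a credit and a resource for the
result. Sizes and credits are polynomials in one parameter. -/
def Shape.Res : Shape → Type
  | base => Unit
  | arr s t => Polynomial ℕ × Polynomial ℕ × s.Res → Polynomial ℕ × t.Res

/-- The resource of shape `base`. -/
def Shape.Res.unit : Shape.base.Res := ()

/-- The trivial resource of a given shape. -/
noncomputable def Shape.defaultRes : (s : Shape) → s.Res
  | base => Res.unit
  | arr _ t => fun _ => (0, t.defaultRes)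

/-- A bound for the size, a credit, and a resource. -/
abbrev Shape.Arg (s : Shape) : Type := Polynomial ℕ × Polynomial ℕ × s.Res

namespace Formula

/-- The shape of a formula. -/
def shape : Formula → Shape
  | var _ => .base
  | all A => shape A
  | mu _ => .base
  | lolli _ B => shape B
  | imp A B => .arr (shape A) (shape B)

theorem shape_ren (ρ : ℕ → ℕ) (A : Formula) : shape (ren ρ A) = shape A := by
  induction A generalizing ρ <;> simp_all [ren, shape]

theorem shape_shift (A : Formula) : shape A.shift = shape A := shape_ren _ A

/-- Variables have shape `base`, as do the formulas put in their place. Hence instantiating a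
quantifier does not change the type of the resources. -/
theorem shape_subst {τ : ℕ → Formula} (h : ∀ n, shape (τ n) = .base) (A : Formula) :
    shape (subst τ A) = shape A := by
  induction A generalizing τ with
  | var n => exact h n
  | all A ih =>
    refine ih fun n => ?_
    cases n
    exacts [rfl, (shape_shift _).trans (h _)]
  | mu A => rfl
  | lolli A B _ ih => exact ih h
  | imp A B ih₁ ih₂ => exact congrArg₂ Shape.arr (ih₁ h) (ih₂ h)

theorem IsLinear.shape {L : Formula} (h : IsLinear L) : L.shape = .base := by
  induction h <;> simp_all [Formula.shape]

theorem shape_inst {L : Formula} (h : IsLinear L) (A : Formula) : shape (inst A L) = shape A :=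
  shape_subst (fun n => (isLinear_instSubst h n).shape) A

end Formula

/-! ### Realizability -/

/-- Sets of values with a credit. -/
abbrev Pred : Type := Set (Term × ℕ)

/-- Candidates: sets of locally closed values with a credit, closed under raising the credit. -/
structure IsCand (X : Pred) : Prop where
  isValue {a : Term × ℕ} : a ∈ X → IsValue a.1
  lc {a : Term × ℕ} : a ∈ X → LC 0 a.1
  up {v : Term} {c d : ℕ} : (v, c) ∈ X → c ≤ d → (v, d) ∈ X

/-- The candidate of all locally closed values. -/
def topCand : Pred := {a | IsValue a.1 ∧ LC 0 a.1}

theorem isCand_topCand : IsCand topCand := ⟨fun h => h.1, fun h => h.2, fun h _ => h⟩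

/-- The term `t` evaluates to a value that belongs to `X` with the credit
that remains of `c` after the cost of the evaluation has been paid. -/
def Ev (X : Pred) (t : Term) (c : ℕ) : Prop :=
  ∃ m k v, m + k ≤ c ∧ Cost t m v ∧ (v, k) ∈ X

theorem Ev.mono {X : Pred} {t : Term} {c d : ℕ} (h : Ev X t c) (hcd : c ≤ d) : Ev X t d := by
  obtain ⟨m, k, v, hm, h⟩ := h
  exact ⟨m, k, v, hm.trans hcd, h⟩

theorem Ev.subset {X Y : Pred} {t : Term} {c : ℕ} (h : Ev X t c) (hXY : X ⊆ Y) : Ev Y t c := by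
  obtain ⟨m, k, v, hm, h, h'⟩ := h
  exact ⟨m, k, v, hm, h, hXY h'⟩

theorem Ev.expand {X : Pred} {t u : Term} {c m : ℕ} (h : Ev X u c) (ht : Cost t m u) :
    Ev X t (m + c) := by
  obtain ⟨m', k, v, hm, h, h'⟩ := h
  exact ⟨m + m', k, v, by omega, ht.trans h, h'⟩

theorem Ev.of_mem {X : Pred} {v : Term} {c : ℕ} (h : (v, c) ∈ X) : Ev X v c :=
  ⟨0, c, v, by omega, .refl v, h⟩

/-- Extend a valuation of the propositional variables to the scope of one more binder. -/
def scons (X : Pred) (η : ℕ → Pred) : ℕ → Pred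
  | 0 => X
  | n + 1 => η n

/-- `Real n A η s r`: the values that realize `A` with the resource `r` for a certain credit, where
`n` is the value of the parameter. The shape `s` is that of `A` in all relevant cases. -/
def Real (n : ℕ) : Formula → (ℕ → Pred) → (s : Shape) → s.Res → Pred
  | var k, η, _, _ => η k
  | all A, η, s, r => {a | ∀ X, IsCand X → a ∈ Real n A (scons X η) s r}
  | mu A, η, s, r => {a | ∀ X, IsCand X → Real n A (scons X η) s r ⊆ X → a ∈ X}
  | lolli L B, η, s, r => {a | a ∈ topCand ∧ ∀ u q, (u, q) ∈ Real n L η .base .unit →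
      Ev (Real n B η s r) (app a.1 u) (a.2 + q)}
  -- A default for a mismatched shape; any candidate would do.
  | imp _ _, _, .base, _ => topCand
  | imp A B, η, .arr s t, f => {a | a ∈ topCand ∧ ∀ (u : Term) (e : s.Arg),
      size u ≤ e.1.eval n → (u, e.2.1.eval n) ∈ Real n A η s e.2.2 →
      Ev (Real n B η t (f e).2) (app a.1 u) (a.2 + (f e).1.eval n)}

theorem isCand_scons {X : Pred} {η : ℕ → Pred} (hX : IsCand X) (hη : ∀ k, IsCand (η k)) (k : ℕ) :
    IsCand (scons X η k) := by
  cases k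
  exacts [hX, hη _]

theorem isCand_real (n : ℕ) (A : Formula) {η : ℕ → Pred} (hη : ∀ k, IsCand (η k)) (s : Shape)
    (r : s.Res) : IsCand (Real n A η s r) := by
  induction A generalizing η s with
  | var k => exact hη k
  | all A ih =>
    have ih' := fun X (hX : IsCand X) => ih (isCand_scons hX hη) s r
    exact ⟨fun h => (ih' _ isCand_topCand).isValue (h _ isCand_topCand),
      fun h => (ih' _ isCand_topCand).lc (h _ isCand_topCand),
      fun h hcd X hX => (ih' X hX).up (h X hX) hcd⟩
  | mu A ih =>
    -- The candidate of all locally closed values is itself closed under the operator, so it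
    -- contains the intersection.
    have ht : ∀ a ∈ Real n (mu A) η s r, a ∈ topCand := fun a h =>
      have hc := ih (isCand_scons isCand_topCand hη) s r
      h _ isCand_topCand fun b hb => ⟨hc.isValue hb, hc.lc hb⟩
    exact ⟨fun h => (ht _ h).1, fun h => (ht _ h).2,
      fun h hcd X hX hp => hX.up (h X hX hp) hcd⟩
  | lolli L B =>
    exact ⟨fun h => h.1.1, fun h => h.1.2,
      fun h hcd => ⟨h.1, fun u q hu => (h.2 u q hu).mono (Nat.add_le_add_right hcd q)⟩⟩
  | imp A B =>
    cases s with
    | base => exact isCand_topCand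
    | arr s t =>
      exact ⟨fun h => h.1.1, fun h => h.1.2,
        fun h hcd => ⟨h.1, fun u e hs hu => (h.2 u e hs hu).mono (Nat.add_le_add_right hcd _)⟩⟩

theorem real_ren (n : ℕ) (ρ : ℕ → ℕ) (A : Formula) (η : ℕ → Pred) (s : Shape) (r : s.Res) :
    Real n (ren ρ A) η s r = Real n A (fun k => η (ρ k)) s r := by
  have key : ∀ (X : Pred) (ρ : ℕ → ℕ) (η : ℕ → Pred),
      (fun k => scons X η (upRen ρ k)) = scons X (fun k => η (ρ k)) := by
    intro X ρ η
    funext k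
    cases k <;> rfl
  induction A generalizing ρ η s with
  | var k => rfl
  | all A ih => simp only [ren, Real, ih, key]
  | mu A ih => simp only [ren, Real, ih, key]
  | lolli L B ih₁ ih₂ => simp only [ren, Real, ih₁, ih₂]
  | imp A B ih₁ ih₂ => cases s <;> simp only [ren, Real, ih₁, ih₂]

theorem real_shift (n : ℕ) (A : Formula) (X : Pred) (η : ℕ → Pred) (s : Shape) (r : s.Res) :
    Real n A.shift (scons X η) s r = Real n A η s r :=
  real_ren n Nat.succ A (scons X η) s r

/-- Only the clause for `⇒` inspects shape and resource. At linear formulas resources can therefore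
be exchanged at will, for instance for the default one. -/
theorem Formula.IsLinear.real_eq {L : Formula} (h : IsLinear L) (n : ℕ) (η : ℕ → Pred) (s : Shape)
    (r : s.Res) : Real n L η s r = Real n L η .base .unit := by
  induction h generalizing η with
  | var k => rfl
  | all _ ih => simp only [Real, ih]
  | mu _ _ ih => simp only [Real, ih]
  | lolli _ _ _ ih => simp only [Real, ih]

/-- As the substituted formulas are linear, their realizers do not depend on a resource, and
substitution amounts to a change of valuation while `A` keeps its own resource. -/
theorem real_subst (n : ℕ) {τ : ℕ → Formula} (h : ∀ k, IsLinear (τ k)) (A : Formula)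
    (η : ℕ → Pred) (s : Shape) (r : s.Res) :
    Real n (subst τ A) η s r = Real n A (fun k => Real n (τ k) η .base .unit) s r := by
  have key : ∀ (X : Pred) (τ : ℕ → Formula) (η : ℕ → Pred),
      (fun k => Real n (upSubst τ k) (scons X η) .base .unit) =
        scons X (fun k => Real n (τ k) η .base .unit) := by
    intro X τ η
    funext k
    cases k
    · rfl
    · exact real_shift n _ X η _ _
  induction A generalizing τ η s with
  | var k => exact (h k).real_eq n η s r
  | all A ih => simp only [subst, Real, ih (isLinear_upSubst h), key]
  | mu A ih => simp only [subst, Real, ih (isLinear_upSubst h), key]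
  | lolli L B ih₁ ih₂ => simp only [subst, Real, ih₁ h, ih₂ h]
  | imp A B ih₁ ih₂ => cases s <;> simp only [subst, Real, ih₁ h, ih₂ h]

theorem real_inst (n : ℕ) {L : Formula} (h : IsLinear L) (A : Formula)
    (η : ℕ → Pred) (s : Shape) (r : s.Res) :
    Real n (inst A L) η s r = Real n A (scons (Real n L η .base .unit) η) s r := by
  rw [inst, real_subst n (isLinear_instSubst h)]
  congr 1
  funext k
  cases k <;> rfl

/-- The two polarities are treated together because the left side of an arrow exchanges them. -/
theorem real_mono (n : ℕ) (A : Formula) {k : ℕ} {η η' : ℕ → Pred} (hk : η k ⊆ η' k)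
    (hη : ∀ m, m ≠ k → η m = η' m) (s : Shape) (r : s.Res) :
    (OccursOnly true k A → Real n A η s r ⊆ Real n A η' s r) ∧
      (OccursOnly false k A → Real n A η' s r ⊆ Real n A η s r) := by
  have key : ∀ (X : Pred) {k : ℕ} {η η' : ℕ → Pred}, (∀ m, m ≠ k → η m = η' m) →
      ∀ m, m ≠ k + 1 → scons X η m = scons X η' m := by
    intro X k η η' hη m hm
    cases m
    · rfl
    · exact hη _ (by omega)
  induction A generalizing k η η' s with
  | var m =>
    by_cases hm : m = k
    · subst hm
      exact ⟨fun _ => hk, fun h => absurd rfl h⟩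
    · exact ⟨fun _ => (hη m hm).subset, fun _ => (hη m hm).symm.subset⟩
  | all A ih =>
    have ih' := fun X => ih (k := k + 1) (η := scons X η) (η' := scons X η') hk (key X hη) s r
    exact ⟨fun h a ha X hX => (ih' X).1 h (ha X hX), fun h a ha X hX => (ih' X).2 h (ha X hX)⟩
  | mu A ih =>
    have ih' := fun X => ih (k := k + 1) (η := scons X η) (η' := scons X η') hk (key X hη) s r
    exact ⟨fun h a ha X hX hp => ha X hX (((ih' X).1 h).trans hp),
      fun h a ha X hX hp => ha X hX (((ih' X).2 h).trans hp)⟩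
  | lolli L B ih₁ ih₂ =>
    have ih₁' := ih₁ hk hη .base .unit
    have ih₂' := ih₂ hk hη s r
    exact ⟨fun h a ha => ⟨ha.1, fun u q hu => (ha.2 u q (ih₁'.2 h.1 hu)).subset (ih₂'.1 h.2)⟩,
      fun h a ha => ⟨ha.1, fun u q hu => (ha.2 u q (ih₁'.1 h.1 hu)).subset (ih₂'.2 h.2)⟩⟩
  | imp A B ih₁ ih₂ =>
    cases s with
    | base => exact ⟨fun _ => subset_rfl, fun _ => subset_rfl⟩
    | arr s t =>
      have ih₁' := ih₁ hk hη s
      have ih₂' := ih₂ hk hη t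
      exact ⟨fun h a ha => ⟨ha.1, fun u e hs hu =>
          (ha.2 u e hs ((ih₁' _).2 h.1 hu)).subset ((ih₂' _).1 h.2)⟩,
        fun h a ha => ⟨ha.1, fun u e hs hu =>
          (ha.2 u e hs ((ih₁' _).1 h.1 hu)).subset ((ih₂' _).2 h.2)⟩⟩

/-- The realizers of `μ α L` are a fixed point. -/
theorem real_mu (n : ℕ) {L : Formula} (h : OccursOnly true 0 L) {η : ℕ → Pred}
    (hη : ∀ k, IsCand (η k)) (s : Shape) (r : s.Res) :
    Real n L (scons (Real n (mu L) η s r) η) s r = Real n (mu L) η s r := by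
  have hc := isCand_real n (mu L) hη s r
  have mono : ∀ {X Y : Pred}, X ⊆ Y → Real n L (scons X η) s r ⊆ Real n L (scons Y η) s r := by
    intro X Y hXY
    refine (real_mono n L (k := 0) hXY ?_ s r).1 h
    rintro (_ | m) hm
    · exact absurd rfl hm
    · rfl
  have h₁ : Real n L (scons (Real n (mu L) η s r) η) s r ⊆ Real n (mu L) η s r :=
    fun a ha X hX hp => hp (mono (fun _ hb => hb X hX hp : Real n (mu L) η s r ⊆ X) ha)
  -- The image of the intersection is a candidate and, by monotonicity, is again closed under the
  -- operator, so it contains the intersection.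
  exact h₁.antisymm fun a ha =>
    ha _ (isCand_real n L (isCand_scons hc hη) s r) (mono h₁)

theorem real_inst_mu (n : ℕ) {L : Formula} (h : IsLinear (mu L)) {η : ℕ → Pred}
    (hη : ∀ k, IsCand (η k)) (s s' : Shape) (r : s.Res) (r' : s'.Res) :
    Real n (inst L (mu L)) η s r = Real n (mu L) η s' r' := by
  rw [real_inst n h, h.real_eq n η s' r']
  cases h with
  | mu hL o => rw [hL.real_eq]; exact real_mu n o hη .base .unit

end DIAL

namespace DIAL

open Term Formula

/-! ### Soundness of the typing rules -/

/-- Sizes, credits and resources for the variables, at all shapes. -/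
abbrev Env : Type := (x : ℕ) → (s : Shape) → s.Arg

/-- The sum of the credits of the variables of a linear context. -/
def credit (d : ℕ → ℕ) (Δ : Ctx) : ℕ := (Δ.map fun a => d a.1).sum

/-- The substitution `σ` realizes the contexts `Γ` and `Δ`. -/
structure Realizes (n : ℕ) (η : ℕ → Pred) (Γ Δ : Ctx) (γ : Env) (σ : ℕ → Term) (d : ℕ → ℕ) :
    Prop where
  lc (x : ℕ) : LC 0 (σ x)
  size_le {a : ℕ × Formula} : a ∈ Γ → size (σ a.1) ≤ (γ a.1 a.2.shape).1.eval n
  int {a : ℕ × Formula} : a ∈ Γ → (σ a.1, (γ a.1 a.2.shape).2.1.eval n) ∈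
    Real n a.2 η a.2.shape (γ a.1 a.2.shape).2.2
  lin {a : ℕ × Formula} : a ∈ Δ → (σ a.1, d a.1) ∈ Real n a.2 η .base .unit

/-- Every instance of `t` by realizers of the contexts evaluates to a realizer of `B`, with a
credit and a resource that are computed from those of the realizers. -/
def Sound (Γ Δ : Ctx) (t : Term) (B : Formula) (s : Shape) : Prop :=
  ∃ (c : Env → Polynomial ℕ) (r : Env → s.Res), ∀ (n : ℕ) (η : ℕ → Pred), (∀ k, IsCand (η k)) →
    ∀ γ σ d, Realizes n η Γ Δ γ σ d →
      Ev (Real n B η s (r γ)) (bind σ t) ((c γ).eval n + credit d Δ)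

section

variable {n : ℕ} {η : ℕ → Pred} {Γ Γ' Δ Δ' : Ctx} {γ : Env} {σ : ℕ → Term} {d : ℕ → ℕ}

theorem credit_add (d : ℕ → ℕ) (Δ Δ' : Ctx) : credit d (Δ + Δ') = credit d Δ + credit d Δ' := by
  simp [credit]

theorem credit_cons (d : ℕ → ℕ) (a : ℕ × Formula) (Δ : Ctx) :
    credit d (a ::ₘ Δ) = d a.1 + credit d Δ := by
  simp [credit]

theorem credit_shift (d : ℕ → ℕ) (Δ : Ctx) : credit d Δ.shift = credit d Δ := by
  simp [credit, Ctx.shift]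

theorem credit_congr {d d' : ℕ → ℕ} {Δ : Ctx} (h : ∀ a ∈ Δ, d a.1 = d' a.1) :
    credit d Δ = credit d' Δ :=
  congrArg Multiset.sum (Multiset.map_congr rfl h)

theorem Realizes.mono (h : Realizes n η Γ Δ γ σ d) (hΓ : Γ' ≤ Γ) (hΔ : Δ' ≤ Δ) :
    Realizes n η Γ' Δ' γ σ d :=
  ⟨h.lc, fun ha => h.size_le (Multiset.mem_of_le hΓ ha), fun ha => h.int (Multiset.mem_of_le hΓ ha),
    fun ha => h.lin (Multiset.mem_of_le hΔ ha)⟩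

theorem Realizes.shift (h : Realizes n η Γ Δ γ σ d) (X : Pred) :
    Realizes n (scons X η) Γ.shift Δ.shift γ σ d := by
  refine ⟨h.lc, fun ha => ?_, fun ha => ?_, fun ha => ?_⟩
  all_goals obtain ⟨b, hb, rfl⟩ := Multiset.mem_map.1 ha
  · dsimp only
    rw [shape_shift]
    exact h.size_le hb
  · simp only [real_shift]
    rw [shape_shift]
    exact h.int hb
  · simpa only [real_shift] using h.lin hb

end

section

variable {Γ Γ₁ Γ₂ Δ Δ₁ Δ₂ : Ctx} {t u : Term} {A B L : Formula}

theorem sound_ax1 (x : ℕ) (A : Formula) : Sound {(x, A)} 0 (fvar x) A A.shape := by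
  refine ⟨fun γ => (γ x A.shape).2.1, fun γ => (γ x A.shape).2.2, fun n η _ γ σ d h => ?_⟩
  exact (Ev.of_mem (h.int (Multiset.mem_singleton_self _))).mono (Nat.le_add_right _ _)

theorem sound_ax2 (x : ℕ) (hL : IsLinear L) : Sound 0 {(x, L)} (fvar x) L L.shape := by
  refine ⟨fun _ => 0, fun _ => Shape.defaultRes _, fun n η _ γ σ d h => ?_⟩
  rw [hL.real_eq]
  refine (Ev.of_mem (h.lin (Multiset.mem_singleton_self _))).mono ?_
  simp [credit]

theorem Sound.muE (hL : IsLinear (mu L)) (h : Sound Γ Δ t (mu L) (mu L).shape) :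
    Sound Γ Δ t (inst L (mu L)) (inst L (mu L)).shape := by
  obtain ⟨c, r, h⟩ := h
  refine ⟨c, fun _ => Shape.defaultRes _, fun n η hη γ σ d hr => ?_⟩
  rw [real_inst_mu n hL hη _ (mu L).shape _ (r γ)]
  exact h n η hη γ σ d hr

theorem Sound.muI (hL : IsLinear (mu L)) (h : Sound Γ Δ t (inst L (mu L)) (inst L (mu L)).shape) :
    Sound Γ Δ t (mu L) (mu L).shape := by
  obtain ⟨c, r, h⟩ := h
  refine ⟨c, fun _ => Shape.defaultRes _, fun n η hη γ σ d hr => ?_⟩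
  rw [← real_inst_mu n hL hη (inst L (mu L)).shape _ (r γ)]
  exact h n η hη γ σ d hr

/-- The credit and the resource are fixed before the valuation, hence common to all candidates. Each
candidate yields an evaluation of its own, but values and costs of evaluations are unique. -/
theorem Sound.allI (h : Sound Γ.shift Δ.shift t A A.shape) :
    Sound Γ Δ t (all A) (all A).shape := by
  obtain ⟨c, r, h⟩ := h
  refine ⟨c, r, fun n η hη γ σ d hr => ?_⟩
  have h' := fun X (hX : IsCand X) => h n _ (isCand_scons hX hη) γ σ d (hr.shift X)
  rw [credit_shift] at h'
  obtain ⟨m, k, v, hm, hv, hk⟩ := h' _ isCand_topCand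
  -- The whole remainder is kept as credit, since it must suffice for every candidate `X`.
  refine ⟨m, (c γ).eval n + credit d Δ - m, v, by omega, hv, fun X hX => ?_⟩
  obtain ⟨m', k', v', hm', hv', hk'⟩ := h' X hX
  have hc := isCand_real n A (isCand_scons hX hη) A.shape (r γ)
  have hc₀ := isCand_real n A (isCand_scons isCand_topCand hη) A.shape (r γ)
  obtain ⟨rfl, rfl⟩ := hv.unique (hc₀.isValue hk) hv' (hc.isValue hk')
  exact hc.up hk' (by omega)

theorem Sound.allE (hL : IsLinear L) (h : Sound Γ Δ t (all A) (all A).shape) :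
    Sound Γ Δ t (inst A L) (inst A L).shape := by
  rw [shape_inst hL]
  obtain ⟨c, r, h⟩ : Sound Γ Δ t (all A) A.shape := h
  refine ⟨c, r, fun n η hη γ σ d hr => ?_⟩
  rw [real_inst n hL]
  exact (h n η hη γ σ d hr).subset fun a ha => ha _ (isCand_real n L hη _ _)

/-- The argument has no linear variables, so its credit is a polynomial determined by `γ` alone and
can be handed to the resource of the function. -/
theorem Sound.impE (hocc : ∀ x, (∀ a ∈ Γ₂, a.1 ≠ x) → occ x u = 0)
    (h₁ : Sound Γ₁ Δ t (imp A B) (imp A B).shape) (h₂ : Sound Γ₂ 0 u A A.shape) :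
    Sound (Γ₁ + Γ₂) Δ (app t u) B B.shape := by
  obtain ⟨c₁, f, h₁⟩ := h₁
  obtain ⟨c₂, r, h₂⟩ := h₂
  -- The sum stands in for the maximum of the sizes of the terms substituted in `u`.
  let K : Env → Polynomial ℕ := fun γ => (Γ₂.map fun a => (γ a.1 a.2.shape).1).sum
  -- The size of the value of `u` is at most the size of the instance of `u` plus the cost `c₂` of
  -- its evaluation.
  let e : Env → A.shape.Arg := fun γ => ((size u : Polynomial ℕ) * (1 + K γ) + c₂ γ, c₂ γ, r γ)
  refine ⟨fun γ => c₁ γ + c₂ γ + (f γ (e γ)).1, fun γ => (f γ (e γ)).2, fun n η hη γ σ d hr => ?_⟩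
  have hr₂ : Realizes n η Γ₂ 0 γ σ d := hr.mono (Multiset.le_add_left _ _) (Multiset.zero_le _)
  obtain ⟨m₁, k₁, v₁, hm₁, hv₁, hk₁⟩ :=
    h₁ n η hη γ σ d (hr.mono (Multiset.le_add_right _ _) le_rfl)
  obtain ⟨m₂, k₂, v₂, hm₂, hv₂, hk₂⟩ := h₂ n η hη γ σ d hr₂
  have hsize : size (bind σ u) ≤ size u * (1 + (K γ).eval n) := by
    refine size_bind_le fun x hx => ?_
    have : ∃ a ∈ Γ₂, a.1 = x := by
      by_contra hcon
      push Not at hcon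
      exact hx (hocc x hcon)
    obtain ⟨a, ha, rfl⟩ := this
    refine (hr₂.size_le ha).trans ?_
    have hK : (K γ).eval n = (Γ₂.map fun a => (γ a.1 a.2.shape).1.eval n).sum :=
      (map_multiset_sum (Polynomial.evalRingHom n) _).trans (by rw [Multiset.map_map]; rfl)
    rw [hK]
    exact Multiset.single_le_sum (fun _ _ => Nat.zero_le _) _
      (Multiset.mem_map_of_mem (fun a : ℕ × Formula => (γ a.1 a.2.shape).1.eval n) ha)
  simp only [credit, Multiset.map_zero, Multiset.sum_zero] at hm₂
  have hs := hv₂.size_le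
  have := hk₁.2 v₂ (e γ) (by simp [e]; omega)
    ((isCand_real n A hη _ _).up hk₂ (by simp [e]; omega))
  refine (this.expand ((hv₁.appL (bind σ u)).trans (hv₂.appR v₁))).mono ?_
  simp only [Polynomial.eval_add]
  omega

theorem Realizes.update_int {n : ℕ} {η : ℕ → Pred} {γ : Env} {σ : ℕ → Term} {d : ℕ → ℕ} {z : ℕ}
    (h : Realizes n η Γ Δ γ σ d) (hz : ∀ a ∈ Γ + Δ, a.1 ≠ z) {v : Term} {e : A.shape.Arg}
    (hv : LC 0 v) (hs : size v ≤ e.1.eval n)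
    (he : (v, e.2.1.eval n) ∈ Real n A η A.shape e.2.2) :
    Realizes n η ((z, A) ::ₘ Γ) Δ (Function.update γ z (Function.update (γ z) A.shape e))
      (Function.update σ z v) d := by
  have hΓ := fun a ha => hz a (Multiset.mem_add.2 (Or.inl ha))
  have hΔ := fun a ha => hz a (Multiset.mem_add.2 (Or.inr ha))
  refine ⟨fun x => ?_, fun {a} ha => ?_, fun {a} ha => ?_, fun {a} ha => ?_⟩
  · by_cases hx : x = z
    · subst hx; simpa
    · simpa [hx] using h.lc x
  · rcases Multiset.mem_cons.1 ha with rfl | ha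
    · simpa
    · simpa [hΓ a ha] using h.size_le ha
  · rcases Multiset.mem_cons.1 ha with rfl | ha
    · simpa
    · simpa [hΓ a ha] using h.int ha
  · simpa [hΔ a ha] using h.lin ha

theorem Realizes.update_lin {n : ℕ} {η : ℕ → Pred} {γ : Env} {σ : ℕ → Term} {d : ℕ → ℕ} {z : ℕ}
    (h : Realizes n η Γ Δ γ σ d) (hz : ∀ a ∈ Γ + Δ, a.1 ≠ z) {v : Term} {q : ℕ}
    (hv : LC 0 v) (hq : (v, q) ∈ Real n L η .base .unit) :
    Realizes n η Γ ((z, L) ::ₘ Δ) γ (Function.update σ z v) (Function.update d z q) := by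
  have hΓ := fun a ha => hz a (Multiset.mem_add.2 (Or.inl ha))
  have hΔ := fun a ha => hz a (Multiset.mem_add.2 (Or.inr ha))
  refine ⟨fun x => ?_, fun {a} ha => ?_, fun {a} ha => ?_, fun {a} ha => ?_⟩
  · by_cases hx : x = z
    · subst hx; simpa
    · simpa [hx] using h.lc x
  · simpa [hΓ a ha] using h.size_le ha
  · simpa [hΓ a ha] using h.int ha
  · rcases Multiset.mem_cons.1 ha with rfl | ha
    · simpa
    · simpa [hΔ a ha] using h.lin ha

theorem Sound.impI {z : ℕ} (hz : ∀ a ∈ Γ + Δ, a.1 ≠ z) (ht : LC 0 t)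
    (h : Sound ((z, A) ::ₘ Γ) Δ t B B.shape) :
    Sound Γ Δ (abs z t) (imp A B) (imp A B).shape := by
  obtain ⟨c, r, h⟩ := h
  let up : Env → A.shape.Arg → Env :=
    fun γ e => Function.update γ z (Function.update (γ z) A.shape e)
  let f : Env → (imp A B).shape.Res :=
    -- The price of the β-step, with `size t` bounding the number of copies, plus the price of the
    -- body. Both depend on the argument and are charged at application; the abstraction itself
    -- needs only the linear credit.
    fun γ e => ((size t : Polynomial ℕ) * e.1 + 1 + c (up γ e), r (up γ e))
  refine ⟨fun _ => 0, f, fun n η hη γ σ d hr => ?_⟩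
  suffices hv : (bind σ (abs z t), credit d Δ) ∈ Real n (imp A B) η (imp A B).shape (f γ) from
    (Ev.of_mem hv).mono (Nat.le_add_left _ _)
  refine ⟨⟨.lam _, ht.closeAt z |>.bind hr.lc⟩, fun u e hs hu => ?_⟩
  have hc := isCand_real n A hη A.shape e.2.2
  have hu' := h n η hη (up γ e) _ d (hr.update_int hz (hc.lc hu) hs hu)
  obtain ⟨m, hm, hle, -⟩ := cost_beta_bind z ht hr.lc (hc.isValue hu)
  refine (hu'.expand hm).mono ?_
  have := Nat.mul_le_mul (occ_le_size z t) hs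
  have hf : (f γ e).1.eval n = size t * e.1.eval n + 1 + (c (up γ e)).eval n := by simp [f]
  dsimp only at hle ⊢
  omega

theorem Sound.lolliE (hL : IsLinear L)
    (h₁ : Sound Γ₁ Δ₁ t (lolli L B) (lolli L B).shape) (h₂ : Sound Γ₂ Δ₂ u L L.shape) :
    Sound (Γ₁ + Γ₂) (Δ₁ + Δ₂) (app t u) B B.shape := by
  obtain ⟨c₁, r₁, h₁⟩ := h₁
  obtain ⟨c₂, r₂, h₂⟩ := h₂
  refine ⟨fun γ => c₁ γ + c₂ γ, r₁, fun n η hη γ σ d hr => ?_⟩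
  obtain ⟨m₁, k₁, v₁, hm₁, hv₁, hk₁⟩ :=
    h₁ n η hη γ σ d (hr.mono (Multiset.le_add_right _ _) (Multiset.le_add_right _ _))
  obtain ⟨m₂, k₂, v₂, hm₂, hv₂, hk₂⟩ :=
    h₂ n η hη γ σ d (hr.mono (Multiset.le_add_left _ _) (Multiset.le_add_left _ _))
  rw [hL.real_eq] at hk₂
  refine ((hk₁.2 v₂ k₂ hk₂).expand ((hv₁.appL (bind σ u)).trans (hv₂.appR v₁))).mono ?_
  simp only [Polynomial.eval_add, credit_add]
  omega

/-- Here the price does not depend on the argument, whose credit is simply added. The abstraction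
thus carries in advance the credit for its body and 1 for the β-step. -/
theorem Sound.lolliI {z : ℕ} (hz : ∀ a ∈ Γ + Δ, a.1 ≠ z) (ht : LC 0 t) (hocc : occ z t ≤ 1)
    (h : Sound Γ ((z, L) ::ₘ Δ) t B B.shape) :
    Sound Γ Δ (abs z t) (lolli L B) (lolli L B).shape := by
  obtain ⟨c, r, h⟩ := h
  refine ⟨fun γ => c γ + 1, r, fun n η hη γ σ d hr => ?_⟩
  refine Ev.of_mem ⟨⟨.lam _, ht.closeAt z |>.bind hr.lc⟩, fun u q hu => ?_⟩
  have hc := isCand_real n L hη .base .unit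
  have hu' := h n η hη γ _ _ (hr.update_lin hz (hc.lc hu) hu)
  obtain ⟨m, hm, -, hle⟩ := cost_beta_bind z ht hr.lc (hc.isValue hu)
  refine (hu'.expand hm).mono ?_
  have hd : credit (Function.update d z q) Δ = credit d Δ := by
    refine credit_congr fun a ha => ?_
    exact Function.update_of_ne (hz a (Multiset.mem_add.2 (Or.inr ha))) _ _
  have := hle hocc
  simp only [credit_cons, hd, Function.update_self, Polynomial.eval_add, Polynomial.eval_one]
  omega

/-- Intuitionistic variables do not enter the sum of credits, so both copies can inherit the full
data of `z`. -/
theorem Sound.contr {x y z : ℕ}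
    (hx : ∀ a ∈ Γ + Δ, a.1 ≠ x) (hy : ∀ a ∈ Γ + Δ, a.1 ≠ y)
    (h : Sound ((x, A) ::ₘ (y, A) ::ₘ Γ) Δ t B B.shape) :
    Sound ((z, A) ::ₘ Γ) Δ (rename y z (rename x z t)) B B.shape := by
  obtain ⟨c, r, h⟩ := h
  let up : Env → Env := fun γ => Function.update (Function.update γ x (γ z)) y (γ z)
  refine ⟨fun γ => c (up γ), fun γ => r (up γ), fun n η hη γ σ d hr => ?_⟩
  rw [bind_rename_rename]
  refine h n η hη (up γ) _ d ?_
  have hσ : ∀ w, w = x ∨ w = y →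
      Function.update (Function.update σ x (σ z)) y (σ z) w = σ z ∧ up γ w = γ z := by
    rintro w hw
    by_cases hw' : w = y
    · subst hw'; simp [up]
    · obtain rfl := hw.resolve_right hw'
      simp [up, hw']
  have hσ' : ∀ a ∈ Γ + Δ,
      Function.update (Function.update σ x (σ z)) y (σ z) a.1 = σ a.1 ∧ up γ a.1 = γ a.1 := by
    intro a ha
    simp [up, hx a ha, hy a ha]
  have hmem : ∀ a ∈ (x, A) ::ₘ (y, A) ::ₘ Γ, ∃ b ∈ (z, A) ::ₘ Γ, a.2 = b.2 ∧
      Function.update (Function.update σ x (σ z)) y (σ z) a.1 = σ b.1 ∧ up γ a.1 = γ b.1 := by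
    intro a ha
    simp only [Multiset.mem_cons] at ha
    rcases ha with rfl | rfl | ha
    · exact ⟨(z, A), Multiset.mem_cons_self _ _, rfl, hσ x (Or.inl rfl)⟩
    · exact ⟨(z, A), Multiset.mem_cons_self _ _, rfl, hσ y (Or.inr rfl)⟩
    · exact ⟨a, Multiset.mem_cons_of_mem ha, rfl, hσ' a (Multiset.mem_add.2 (Or.inl ha))⟩
  refine ⟨fun w => ?_, fun {a} ha => ?_, fun {a} ha => ?_, fun {a} ha => ?_⟩
  · by_cases hw : w = x ∨ w = y
    · rw [(hσ w hw).1]; exact hr.lc z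
    · push Not at hw
      simpa [hw.1, hw.2] using hr.lc w
  · obtain ⟨b, hb, h₁, h₂, h₃⟩ := hmem a ha
    rw [h₁, h₂, h₃]
    exact hr.size_le hb
  · obtain ⟨b, hb, h₁, h₂, h₃⟩ := hmem a ha
    rw [h₁, h₂, h₃]
    exact hr.int hb
  · rw [(hσ' a (Multiset.mem_add.2 (Or.inr ha))).1]
    exact hr.lin ha

/-- Each dereliction pays the credit of `x` once; this is where uses of an intuitionistic variable
are charged. -/
theorem Sound.derel {x : ℕ} (hL : IsLinear L) (hx : ∀ a ∈ Γ + Δ, a.1 ≠ x)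
    (h : Sound Γ ((x, L) ::ₘ Δ) t B B.shape) : Sound ((x, L) ::ₘ Γ) Δ t B B.shape := by
  obtain ⟨c, r, h⟩ := h
  refine ⟨fun γ => c γ + (γ x L.shape).2.1, r, fun n η hη γ σ d hr => ?_⟩
  have hm := hr.int (Multiset.mem_cons_self _ _)
  rw [hL.real_eq] at hm
  have h' := h n η hη γ _ _
    ((hr.mono (Multiset.le_cons_self _ _) le_rfl).update_lin hx (hr.lc x) hm)
  have hd : ∀ q, credit (Function.update d x q) Δ = credit d Δ := fun q =>
    credit_congr fun a ha => Function.update_of_ne (hx a (Multiset.mem_add.2 (Or.inr ha))) _ _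
  rw [Function.update_eq_self] at h'
  refine h'.mono ?_
  simp only [credit_cons, hd, Function.update_self, Polynomial.eval_add]
  omega

theorem Sound.weak (Γ' Δ' : Ctx) (h : Sound Γ Δ t B B.shape) :
    Sound (Γ + Γ') (Δ + Δ') t B B.shape := by
  obtain ⟨c, r, h⟩ := h
  refine ⟨c, r, fun n η hη γ σ d hr => ?_⟩
  refine (h n η hη γ σ d (hr.mono (Multiset.le_add_right _ _) (Multiset.le_add_right _ _))).mono ?_
  rw [credit_add]
  omega

end

theorem Typed.sound {Γ Δ : Ctx} {t : Term} {A : Formula} (h : Typed Γ Δ t A) :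
    Sound Γ Δ t A A.shape := by
  induction h with
  | ax1 x => exact sound_ax1 x _
  | ax2 x hL => exact sound_ax2 x hL
  | muE h ih => exact ih.muE h.isFormula.1.isLinear_of_mu
  | muI hL _ ih => exact ih.muI hL
  | allI _ ih => exact ih.allI
  | allE hL _ ih => exact ih.allE hL
  | impE _ _ h₂ ih₁ ih₂ =>
    exact Sound.impE (fun x hx => h₂.occ_eq_zero (by simpa using hx)) ih₁ ih₂
  | impI h ih =>
    have hd := h.distinct
    rw [Multiset.cons_add] at hd
    exact ih.impI hd.notMem h.lc
  | lolliE _ h₁ _ ih₁ ih₂ => exact Sound.lolliE h₁.isFormula.1.of_lolli.1 ih₁ ih₂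
  | lolliI h ih =>
    have hd := h.distinct
    rw [Multiset.add_cons] at hd
    exact ih.lolliI hd.notMem h.lc (h.occ_le_one (Multiset.mem_cons_self _ _))
  | contr _ h ih =>
    have hd := h.distinct
    rw [Multiset.cons_add, Multiset.cons_add] at hd
    refine ih.contr (fun a ha => hd.notMem a (Multiset.mem_cons_of_mem ha)) ?_
    exact (hd.mono (Multiset.le_cons_self _ _)).notMem
  | derel h ih =>
    have hd := h.distinct
    rw [Multiset.add_cons] at hd
    exact ih.derel (h.isFormula.2.2 _ (Multiset.mem_cons_self _ _)) hd.notMem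
  | weak _ _ _ _ ih => exact ih.weak _ _

end DIAL

namespace DIAL

open Term Formula

/-! ### Church words -/

namespace Term

theorem size_closeAt (x k : ℕ) (t : Term) : size (closeAt x k t) = size t := by
  induction t generalizing k with
  | bvar i => rfl
  | fvar y => simp only [closeAt]; split_ifs <;> rfl
  | lam t ih => simp [closeAt, size, ih]
  | app t s iht ihs => simp [closeAt, size, iht, ihs]

variable (w : List Bool)

theorem size_churchBody : size (churchBody (fvar 0) (fvar 1) (fvar 2) w) = w.length + 1 := by
  induction w with
  | nil => rfl
  | cons b w ih => 
    cases b <;> simp [churchBody, size, ih] <;> omega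

theorem size_churchWord : size (churchWord w) = w.length + 4 := by
  simp [churchWord, abs, size, size_closeAt, size_churchBody]

theorem lc_churchBody : LC 0 (churchBody (fvar 0) (fvar 1) (fvar 2) w) := by
  induction w with
  | nil => trivial
  | cons b w ih => cases b <;> exact ⟨trivial, ih⟩

theorem occ_churchBody_le {x : ℕ} (hx : x ≠ 2) :
    occ x (churchBody (fvar 0) (fvar 1) (fvar 2) w) ≤ w.length := by
  induction w with
  | nil => simp [churchBody, occ, hx.symm]
  | cons b w ih =>
    have : occ x (if b then fvar 1 else fvar 0) ≤ 1 := by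
      cases b <;> simp only [occ, if_true, if_false, Bool.false_eq_true] <;> split_ifs <;> omega
    simp only [churchBody, occ, List.length_cons]
    omega

theorem occ_churchBody_two : occ 2 (churchBody (fvar 0) (fvar 1) (fvar 2) w) = 1 := by
  induction w with
  | nil => rfl
  | cons b w ih => cases b <;> simp [churchBody, occ, ih]

theorem bind_churchBody (σ : ℕ → Term) :
    bind σ (churchBody (fvar 0) (fvar 1) (fvar 2) w) = churchBody (σ 0) (σ 1) (σ 2) w := by
  induction w with
  | nil => rfl
  | cons b w ih => cases b <;> simp [churchBody, bind, ih]

end Term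

/-- Evaluation proceeds from the innermost application outwards, and each letter consumes the credit
of one of the two functions. Adding `q₀ + q₁` per letter avoids counting the letters separately. -/
theorem ev_churchBody {X : Pred} {f₀ f₁ u : Term} {q₀ q₁ q : ℕ}
    (h₀ : ∀ u q, (u, q) ∈ X → Ev X (app f₀ u) (q₀ + q))
    (h₁ : ∀ u q, (u, q) ∈ X → Ev X (app f₁ u) (q₁ + q)) (hu : (u, q) ∈ X) (w : List Bool) :
    Ev X (churchBody f₀ f₁ u w) (w.length * (q₀ + q₁) + q) := by
  induction w with
  | nil => simpa [churchBody] using Ev.of_mem hu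
  | cons b w ih =>
    obtain ⟨m, k, v, hm, hv, hk⟩ := ih
    have h : Ev X (app (if b then f₁ else f₀) v) (q₀ + q₁ + k) := by
      cases b
      · exact (h₀ v k hk).mono (by omega)
      · exact (h₁ v k hk).mono (by omega)
    refine (h.expand (hv.appR _)).mono ?_
    simp only [List.length_cons, add_mul]
    omega

/-- The resource of the Church words, where the parameter is the length of the word. -/
noncomputable def churchRes : churchW.shape.Res := fun e₀ =>
  -- The first β-step copies `f₀` at most once per letter.
  (Polynomial.X * e₀.1 + 1, fun e₁ =>
    -- The copies of `f₁`, then the credits for running all the letters; the constant 2 pays for the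
    -- β-steps of `f₁` and of `x`.
    (Polynomial.X * e₁.1 + Polynomial.X * (e₀.2.1 + e₁.2.1) + 2, Shape.Res.unit))

theorem churchWord_mem_real (w : List Bool) (η : ℕ → Pred) :
    (churchWord w, 0) ∈ Real w.length churchW η churchW.shape churchRes := by
  intro X hX
  set body := churchBody (fvar 0) (fvar 1) (fvar 2) w with hbody
  have lc₂ : LC 0 (abs 2 body) := (lc_churchBody w).closeAt 2
  have lc₁ : LC 0 (abs 1 (abs 2 body)) := lc₂.closeAt 1
  have lcu : ∀ {σ : ℕ → Term} {v : Term} (z : ℕ), (∀ x, LC 0 (σ x)) → LC 0 v →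
      ∀ x, LC 0 (Function.update σ z v x) := by
    intro σ v z hσ hv x
    by_cases hx : x = z
    · subst hx; simpa
    · simpa [hx] using hσ x
  refine ⟨⟨.lam _, lc₁.closeAt 0⟩, fun f₀ e₀ hs₀ h₀ => ?_⟩
  have hσ₀ : ∀ x, LC 0 (fvar x) := fun _ => trivial
  obtain ⟨m₀, hm₀, hle₀, -⟩ := cost_beta_bind 0 lc₁ hσ₀ h₀.1.1
  rw [bind_fvar] at hm₀
  have hσ₁ := lcu 0 hσ₀ h₀.1.2
  have ho₀ : occ 0 (abs 1 (abs 2 body)) ≤ w.length :=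
    ((occ_abs_of_ne (by decide : 0 ≠ 1) _).trans
      (occ_abs_of_ne (by decide : 0 ≠ 2) body)).trans_le
      (occ_churchBody_le w (by decide))
  have hle₀' : m₀ ≤ w.length * e₀.1.eval w.length + 1 :=
    hle₀.trans (Nat.succ_le_succ (Nat.mul_le_mul ho₀ hs₀))
  suffices h : Ev (Real w.length (imp (lolli (var 0) (var 0)) (lolli (var 0) (var 0)))
      (scons X η) (.arr .base .base) (churchRes e₀).2)
      (bind (Function.update fvar 0 f₀) (abs 1 (abs 2 body))) 0 by
    refine (h.expand hm₀).mono ?_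
    have : (churchRes e₀).1.eval w.length = w.length * e₀.1.eval w.length + 1 := by
      simp [churchRes]
    dsimp only
    omega
  refine Ev.of_mem ⟨⟨.lam _, (lc₂.closeAt 1).bind hσ₁⟩, fun f₁ e₁ hs₁ h₁ => ?_⟩
  obtain ⟨m₁, hm₁, hle₁, -⟩ := cost_beta_bind 1 lc₂ hσ₁ h₁.1.1
  have hσ₂ := lcu 1 hσ₁ h₁.1.2
  have ho₁ : occ 1 (abs 2 body) ≤ w.length :=
    (occ_abs_of_ne (by decide : 1 ≠ 2) body).trans_le (occ_churchBody_le w (by decide))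
  have hle₁' : m₁ ≤ w.length * e₁.1.eval w.length + 1 :=
    hle₁.trans (Nat.succ_le_succ (Nat.mul_le_mul ho₁ hs₁))
  suffices h : Ev (Real w.length (lolli (var 0) (var 0)) (scons X η) .base .unit)
      (bind (Function.update (Function.update fvar 0 f₀) 1 f₁) (abs 2 body))
      -- The credit stored in the abstraction over `x`: all the letters, and 1 for its own β-step.
      (w.length * (e₀.2.1.eval w.length + e₁.2.1.eval w.length) + 1) by
    refine (h.expand hm₁).mono ?_
    have : ((churchRes e₀).2 e₁).1.eval w.length = w.length * e₁.1.eval w.length +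
        w.length * (e₀.2.1.eval w.length + e₁.2.1.eval w.length) + 2 := by
      simp [churchRes]
    dsimp only
    omega
  refine Ev.of_mem ⟨⟨.lam _, ((lc_churchBody w).closeAt 2).bind hσ₂⟩, fun u q hu => ?_⟩
  have hu' : (u, q) ∈ X := hu
  obtain ⟨m₂, hm₂, -, hle₂⟩ := cost_beta_bind 2 (lc_churchBody w) hσ₂ (hX.isValue hu')
  have hle₂' := hle₂ (occ_churchBody_two w).le
  rw [bind_churchBody] at hm₂
  have h : Ev X _ _ := ev_churchBody h₀.2 h₁.2 hu' w
  refine (h.expand hm₂).mono ?_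
  dsimp only
  omega

end DIAL

/-! ### The polynomial bound -/

theorem theorem4 (L : DIAL.Formula) (hL : L.IsLinear) (t : DIAL.Term)
    (ht : DIAL.Typed 0 0 t (DIAL.Formula.imp DIAL.Formula.churchW L)) :
    ∃ P : Polynomial ℕ, ∀ w : List Bool,
      (∃ n : ℕ, (DIAL.Term.app t (DIAL.Term.churchWord w)).HasTime n) ∧
      ∀ n : ℕ, (DIAL.Term.app t (DIAL.Term.churchWord w)).HasTime n → n ≤ P.eval w.length := by
  obtain ⟨c, f, h⟩ := ht.sound
  -- The contexts are empty, so the environment is arbitrary.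
  let γ : DIAL.Env := fun _ s => (0, 0, s.defaultRes)
  -- The same data for all words: evaluated at the length of `w`, the first component is exactly the
  -- size of the Church word.
  let e : DIAL.Formula.churchW.shape.Arg := (Polynomial.X + 4, 0, DIAL.churchRes)
  refine ⟨c γ + (f γ e).1, fun w => ?_⟩
  have hη : ∀ _ : ℕ, DIAL.IsCand DIAL.topCand := fun _ => DIAL.isCand_topCand
  obtain ⟨m₁, k₁, v₁, hm₁, hv₁, hk₁⟩ := h w.length (fun _ => DIAL.topCand) hη γ DIAL.Term.fvar 0
    ⟨fun _ => trivial, fun ha => absurd ha (Multiset.notMem_zero _),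
      fun ha => absurd ha (Multiset.notMem_zero _), fun ha => absurd ha (Multiset.notMem_zero _)⟩
  rw [DIAL.Term.bind_fvar] at hv₁
  obtain ⟨m₂, k₂, v₂, hm₂, hv₂, hk₂⟩ := hk₁.2 (DIAL.Term.churchWord w) e
    (by simp [e, DIAL.Term.size_churchWord])
    (by simpa [e] using DIAL.churchWord_mem_real w _)
  have hval := (DIAL.isCand_real w.length L hη _ _).isValue hk₂
  have hcost := (hv₁.appL (DIAL.Term.churchWord w)).trans hv₂
  refine ⟨⟨m₁ + m₂, v₂, hval, hcost⟩, ?_⟩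
  rintro n ⟨v, hv, hn⟩
  obtain ⟨rfl, -⟩ := hn.unique hv hcost hval
  simp only [DIAL.credit, Multiset.map_zero, Multiset.sum_zero] at hm₁
  simp only [Polynomial.eval_add]
  dsimp only at hm₂
  omega
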